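/- Let $0<r<1$, let $\phi=(\phi_1,\phi_2)$ be an odd holomorphic $\mathbb C^2$-valued function on $\{|z|<r\}$ such that $\phi'(0)$ and $\overline{\phi'(0)}$ are linearly independent over $\mathbb C$, and let $\tau(z)=-z$. Near $z=\infty$ write $\phi(z)=\overline{\phi(-1/\bar z)}$ for the function on $D_2=\{|z|>1/r\}\subset\mathbb P^1$ obtained from $\phi$ through the antipodal map $z\mapsto-1/\bar z$. Put $D_1=\{|z|<r\}$, $\Omega=\{r/2<|z|<2/r\}$, and let $U\subset\mathbb C^2$ be an open neighbourhood of $0$, so small that $v$ and $v+\phi(z)$ never both lie in $U$ when $r/2<|z|<r$ or $1/r<|z|<2/r$. The twistor space of $(\tau,\phi)$ is the complex threefold $Z=X_1\cup X_\Omega\cup X_2$, where $X_i$ is the quotient of $D_i\times U$ by $(z,v)\sim(-z,v+\phi(z))$ and $X_\Omega=\Omega\times U$, glued along the overlaps $D_i\cap\Omega$. It carries the local $\mathbb C^2$-action $t\cdot[z,v]=[z,v+t]$ and contains the central twistor line $L=\{[z,0]\}\cong\mathbb P^1$; the twistor lines are the rational curves near $L$. Let $q_1,q_2$ be a basis of the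 space of quadratic polynomials of the form $az^2+b$, $a,b\in\mathbb C$, and suppose that $$q_1(z)\phi_1'(z)+q_2(z)\phi_2'(z)=2$$ both on $D_1$ and, for the function $\phi(z)=\overline{\phi(-1/\bar z)}$, on $D_2\setminus\{\infty\}$. (The second condition follows from the first if the vector fields $q_i\,\partial_z$ are compatible with the antipodal map, i.e. $q_i=a_iz^2+\bar a_i$, as for $q_1=z^2+1$, $q_2=i(z^2-1)$.) Then there are a holomorphic line bundle $K^{-1/2}$ on $Z$ with $(K^{-1/2})^{\otimes2}\cong K^{-1}$, where $K$ is the canonical bundle of $Z$, and a twisted holomorphic contact structure $\theta\in H^0(Z,T^*Z\otimes K^{-1/2})$ (that is, $\theta$ has no zeros and $\ker\theta$ is maximally non-integrable) which is invariant under the $\mathbb C^2$-action and non-zero on twistor lines: the restriction of $\theta$ to $L$, a section of $T^*L\otimes K^{-1/2}|_L$, has no zeros, and the same holds for every parametrised holomorphic rational curve $\mathbb P^1\to Z$ in some neighbourhood, in the compact-open topology, of the inclusion $L\subset Z$. -/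

import Mathlib

open Set Filter Topology Metric Bundle
open scoped Manifold ContDiff ComplexConjugate Polynomial

noncomputable section

namespace ToricTwistor

/-! ### The Riemann sphere and its two poles -/

/-- The two points `0` and `∞` of the Riemann sphere. -/
inductive Pole
  | zero
  | infty

/-- The standard coordinate of the Riemann sphere `ℂ ∪ {∞}` centred at a pole: `z ↦ z` at `0`
and `ζ ↦ ζ⁻¹` (with `0 ↦ ∞`) at `∞`. -/
def Pole.coord : Pole → ℂ → OnePoint ℂ
  | zero, z => (z : OnePoint ℂ)
  | infty, ζ => if ζ = 0 then OnePoint.infty else ((ζ⁻¹ : ℂ) : OnePoint ℂ)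

/-- The antipodal map `z ↦ -1 / conj z` of the Riemann sphere (away from `0` and `∞`). -/
def antipode (z : ℂ) : ℂ := -(conj z)⁻¹

/-- The function `z ↦ conj (φ (-1 / conj z))` which the real structure attaches to `φ` near `∞`. -/
def reflected (φ : ℂ → Fin 2 → ℂ) (z : ℂ) : Fin 2 → ℂ := fun j => conj (φ (antipode z) j)

/-- The function which glues near a pole, in the coordinate centred at that pole. Near `0` it is
`φ`; near `∞`, in the coordinate `ζ = 1 / z`, it is `ζ ↦ conj (φ (-conj ζ))`, that is
`reflected φ (1 / ζ)`. -/
def poleMap (φ : ℂ → Fin 2 → ℂ) : Pole → ℂ → Fin 2 → ℂ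
  | Pole.zero => φ
  | Pole.infty => fun ζ j => conj (φ (-conj ζ) j)

theorem poleMap_infty_eq (φ : ℂ → Fin 2 → ℂ) (ζ : ℂ) :
    poleMap φ Pole.infty ζ = reflected φ ζ⁻¹ := by
  funext j
  simp [poleMap, reflected, antipode]

/-- The coordinate space `ℂ × ℂ²` of the twistor space. -/
abbrev Model : Type := ℂ × (Fin 2 → ℂ)

/-! ### The data `(τ, φ)` with `τ z = -z`, and the twistor space -/

/-- A pair `(τ, φ)` with `τ z = -z`, together with the choices that enter the construction of the
twistor space: the radius `r < 1` of the disc on which `φ` is used and the neighbourhood `U` of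
`0 ∈ ℂ²`, so small that the identifications `(z, v) ∼ (-z, v + φ z)` are void for
`r / 2 < |z| < r`, i.e. near the boundary of each of the two discs. -/
structure ToricData where
  /-- the radius of the two discs -/
  r : ℝ
  r_pos : 0 < r
  r_lt_one : r < 1
  /-- the `ℂ²`-valued odd holomorphic function -/
  φ : ℂ → Fin 2 → ℂ
  holomorphic : DifferentiableOn ℂ φ (ball 0 r)
  odd : ∀ z ∈ ball (0 : ℂ) r, φ (-z) = -φ z
  independent : LinearIndependent ℂ ![deriv φ 0, fun j => conj (deriv φ 0 j)]
  /-- the neighbourhood of the origin in `ℂ²` -/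
  U : Set (Fin 2 → ℂ)
  isOpen_U : IsOpen U
  zero_mem_U : 0 ∈ U
  separated : ∀ (e : Pole) (z : ℂ), r / 2 < ‖z‖ → ‖z‖ < r →
    ∀ v ∈ U, v + poleMap φ e z ∉ U

namespace ToricData

variable (T : ToricData)

/-- The product of the Riemann sphere with `U`. -/
abbrev Pre : Type := {p : OnePoint ℂ × (Fin 2 → ℂ) // p.2 ∈ T.U}

/-- The identifications `(z, v) ∼ (-z, v + φ z)` for `|z| < r`, and likewise near `z = ∞`. -/
def Rel (x y : T.Pre) : Prop :=
  x = y ∨ ∃ (e : Pole) (z : ℂ), ‖z‖ < T.r ∧ x.1.1 = e.coord z ∧ y.1.1 = e.coord (-z) ∧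
    y.1.2 = x.1.2 + poleMap T.φ e z

end ToricData

theorem Pole.coord_injective (e : Pole) : Function.Injective e.coord := by
  intro a b h
  cases e with
  | zero => simpa [Pole.coord] using h
  | infty =>
    by_cases ha : a = 0 <;> by_cases hb : b = 0 <;> simp_all [Pole.coord]

theorem Pole.coord_eq_of_norm_lt_one {e e' : Pole} {z w : ℂ} (hz : ‖z‖ < 1) (hw : ‖w‖ < 1)
    (h : e.coord z = e'.coord w) : e = e' := by
  have key : ∀ a b : ℂ, ‖a‖ < 1 → ‖b‖ < 1 → Pole.zero.coord a ≠ Pole.infty.coord b := by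
    intro a b ha hb hab
    by_cases hb0 : b = 0
    · simp [Pole.coord, hb0] at hab
    · simp only [Pole.coord, hb0, if_false, OnePoint.coe_eq_coe] at hab
      rw [hab, norm_inv] at ha
      have := one_lt_inv₀ (norm_pos_iff.2 hb0) |>.2 hb
      linarith
  cases e <;> cases e'
  · rfl
  · exact absurd h (key _ _ hz hw)
  · exact absurd h.symm (key _ _ hw hz)
  · rfl

namespace ToricData

variable (T : ToricData)

theorem poleMap_neg (e : Pole) {z : ℂ} (hz : ‖z‖ < T.r) :
    poleMap T.φ e (-z) = -poleMap T.φ e z := by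
  cases e with
  | zero => exact T.odd z (by simpa using hz)
  | infty =>
    funext j
    have := T.odd (-conj z) (by simpa using hz)
    simp only [poleMap, map_neg, neg_neg, Pi.neg_apply] at this ⊢
    rw [this]
    simp

theorem rel_equivalence : Equivalence T.Rel where
  refl x := Or.inl rfl
  symm := by
    rintro x y (rfl | ⟨e, z, hz, h1, h2, h3⟩)
    · exact Or.inl rfl
    · refine Or.inr ⟨e, -z, by simpa using hz, h2, by simpa using h1, ?_⟩
      rw [h3, T.poleMap_neg e hz]; abel
  trans := by
    rintro x y w (rfl | ⟨e, z, hz, h1, h2, h3⟩) (rfl | ⟨e', z', hz', h1', h2', h3'⟩)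
    · exact Or.inl rfl
    · exact Or.inr ⟨e', z', hz', h1', h2', h3'⟩
    · exact Or.inr ⟨e, z, hz, h1, h2, h3⟩
    · left
      have h := h2.symm.trans h1'
      have hr := T.r_lt_one
      obtain rfl := Pole.coord_eq_of_norm_lt_one (by simpa using hz.trans hr) (hz'.trans hr) h
      obtain rfl := e.coord_injective h
      refine Subtype.ext (Prod.ext ?_ ?_)
      · rw [h1, h2', neg_neg]
      · rw [h3', h3, T.poleMap_neg e hz]; abel

/-- The equivalence relation on `ℙ¹ × U` generated by the identifications. -/
instance setoid : Setoid T.Pre := ⟨T.Rel, T.rel_equivalence⟩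

/-- The twistor space `Z` of `(τ, φ)`: the quotient of `ℙ¹ × U` by the identifications
`(z, v) ∼ (-z, v + φ z)` near `z = 0` and `z = ∞`. It is the union of the three open pieces
`X₁ = (D₁ × U) / ∼`, `X_Ω = Ω × U` and `X₂ = (D₂ × U) / ∼` for `D₁ = {|z| < r}`,
`Ω = {r / 2 < |z| < 2 / r}`, `D₂ = {1 / r < |z|}`, glued along the overlaps `D_i ∩ Ω`, over which
`∼` is trivial. -/
def Z : Type := Quotient T.setoid

instance : TopologicalSpace T.Z := inferInstanceAs (TopologicalSpace (Quotient T.setoid))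

/-- The quotient map. -/
def proj (x : T.Pre) : T.Z := Quotient.mk T.setoid x

open Classical in
/-- The point `[z, v]` of the twistor space (meaningful for `v ∈ U`). -/
def point (z : OnePoint ℂ) (v : Fin 2 → ℂ) : T.Z :=
  if h : v ∈ T.U then T.proj ⟨(z, v), h⟩ else T.proj ⟨(z, 0), T.zero_mem_U⟩

theorem point_of_mem (z : OnePoint ℂ) {v : Fin 2 → ℂ} (h : v ∈ T.U) :
    T.point z v = T.proj ⟨(z, v), h⟩ := dif_pos h

theorem proj_eq_iff {x y : T.Pre} : T.proj x = T.proj y ↔ T.Rel x y := Quotient.eq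

theorem continuous_proj : Continuous T.proj := continuous_quotient_mk'

end ToricData

/-! ### Topology of the coordinates -/

/-- Inversion of the Riemann sphere. -/
def sphereInv (x : OnePoint ℂ) : OnePoint ℂ := x.elim ((0 : ℂ) : OnePoint ℂ) Pole.infty.coord

theorem sphereInv_sphereInv (x : OnePoint ℂ) : sphereInv (sphereInv x) = x := by
  induction x using OnePoint.rec with
  | infty => simp [sphereInv, Pole.coord]
  | coe z => by_cases hz : z = 0 <;> simp [sphereInv, Pole.coord, hz]

theorem continuous_sphereInv : Continuous sphereInv := by
  rw [OnePoint.continuous_iff]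
  constructor
  · have h1 : Tendsto (fun z : ℂ => ((z⁻¹ : ℂ) : OnePoint ℂ)) (coclosedCompact ℂ)
        (𝓝 ((0 : ℂ) : OnePoint ℂ)) := by
      rw [coclosedCompact_eq_cocompact, ← Metric.cobounded_eq_cocompact]
      exact (OnePoint.continuous_coe.tendsto 0).comp tendsto_inv₀_cobounded
    refine h1.congr' ?_
    have : ∀ᶠ z : ℂ in coclosedCompact ℂ, z ≠ 0 := by
      rw [coclosedCompact_eq_cocompact]
      exact (isCompact_singleton (x := (0 : ℂ))).compl_mem_cocompact
    filter_upwards [this] with z hz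
    simp [sphereInv, Pole.coord, hz]
  · rw [continuous_iff_continuousAt]
    intro z
    by_cases hz : z = 0
    · subst hz
      rw [continuousAt_iff_punctured_nhds]
      have h1 : Tendsto (fun z : ℂ => ((z⁻¹ : ℂ) : OnePoint ℂ)) (𝓝[≠] 0)
          (𝓝 (OnePoint.infty : OnePoint ℂ)) := by
        have h2 := OnePoint.tendsto_coe_infty (X := ℂ)
        rw [coclosedCompact_eq_cocompact, ← Metric.cobounded_eq_cocompact] at h2
        exact h2.comp tendsto_inv₀_nhdsNE_zero
      have h3 : sphereInv ((0 : ℂ) : OnePoint ℂ) = OnePoint.infty := by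
        simp [sphereInv, Pole.coord]
      rw [h3]
      refine h1.congr' ?_
      filter_upwards [self_mem_nhdsWithin] with z hz
      have hz' : z ≠ 0 := hz
      simp [sphereInv, Pole.coord, hz']
    · have h1 : ContinuousAt (fun z : ℂ => ((z⁻¹ : ℂ) : OnePoint ℂ)) z :=
        OnePoint.continuous_coe.continuousAt.comp (continuousAt_inv₀ hz)
      refine h1.congr ?_
      filter_upwards [isOpen_ne.mem_nhds hz] with w hw
      have hw' : w ≠ 0 := hw
      simp [sphereInv, Pole.coord, hw']

theorem Pole.isOpenEmbedding_coord (e : Pole) : IsOpenEmbedding e.coord := by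
  cases e with
  | zero => exact OnePoint.isOpenEmbedding_coe
  | infty =>
    let h : OnePoint ℂ ≃ₜ OnePoint ℂ :=
      ⟨⟨sphereInv, sphereInv, sphereInv_sphereInv, sphereInv_sphereInv⟩,
        continuous_sphereInv, continuous_sphereInv⟩
    exact h.isOpenEmbedding.comp OnePoint.isOpenEmbedding_coe

/-- Two continuous open maps with the same fibres induce a homeomorphism of their images. -/
def homeoOfFibres {X A B : Type*} [TopologicalSpace X] [TopologicalSpace A] [TopologicalSpace B]
    [Nonempty X] (g : X → A) (f : X → B) (hg : Continuous g) (hf : Continuous f)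
    (hg' : IsOpenMap g) (hf' : IsOpenMap f) (h : ∀ x y, g x = g y ↔ f x = f y) :
    OpenPartialHomeomorph A B where
  toFun a := f (Function.invFun g a)
  invFun b := g (Function.invFun f b)
  source := range g
  target := range f
  map_source' _ _ := mem_range_self _
  map_target' _ _ := mem_range_self _
  left_inv' := by
    rintro _ ⟨x, rfl⟩
    have h1 := (h _ _).1 (Function.invFun_eq (f := g) ⟨x, rfl⟩)
    exact ((h _ _).2 (Function.invFun_eq (f := f) ⟨_, rfl⟩)).trans ((h _ _).2 h1)
  right_inv' := by
    rintro _ ⟨x, rfl⟩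
    have h1 := (h _ _).2 (Function.invFun_eq (f := f) ⟨x, rfl⟩)
    exact ((h _ _).1 (Function.invFun_eq (f := g) ⟨_, rfl⟩)).trans ((h _ _).1 h1)
  open_source := hg'.isOpen_range
  open_target := hf'.isOpen_range
  continuousOn_toFun := by
    refine continuousOn_iff'.2 fun t ht => ⟨g '' (f ⁻¹' t), hg' _ (ht.preimage hf), ?_⟩
    ext a
    constructor
    · rintro ⟨h1, x, rfl⟩
      exact ⟨⟨_, h1, Function.invFun_eq (f := g) ⟨x, rfl⟩⟩, mem_range_self _⟩
    · rintro ⟨⟨x, hx, rfl⟩, -⟩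
      refine ⟨?_, mem_range_self _⟩
      have := (h _ _).1 (Function.invFun_eq (f := g) ⟨x, rfl⟩)
      simpa [this] using hx
  continuousOn_invFun := by
    refine continuousOn_iff'.2 fun t ht => ⟨f '' (g ⁻¹' t), hf' _ (ht.preimage hg), ?_⟩
    ext a
    constructor
    · rintro ⟨h1, x, rfl⟩
      exact ⟨⟨_, h1, Function.invFun_eq (f := f) ⟨x, rfl⟩⟩, mem_range_self _⟩
    · rintro ⟨⟨x, hx, rfl⟩, -⟩
      refine ⟨?_, mem_range_self _⟩
      have := (h _ _).2 (Function.invFun_eq (f := f) ⟨x, rfl⟩)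
      simpa [this] using hx

theorem homeoOfFibres_apply {X A B : Type*} [TopologicalSpace X] [TopologicalSpace A]
    [TopologicalSpace B] [Nonempty X] (g : X → A) (f : X → B) (hg : Continuous g)
    (hf : Continuous f) (hg' : IsOpenMap g) (hf' : IsOpenMap f)
    (h : ∀ x y, g x = g y ↔ f x = f y) (x : X) :
    homeoOfFibres g f hg hf hg' hf' h (g x) = f x :=
  (h _ _).1 (Function.invFun_eq (f := g) ⟨x, rfl⟩)

/-- The three pieces of the twistor space: the two (quotients of) discs times `U`, and the
annulus times `U`. -/
inductive Piece
  | disc (e : Pole)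
  | annulus

/-- The coordinate of the Riemann sphere used on a piece. -/
def Piece.coord : Piece → ℂ → OnePoint ℂ
  | disc e => e.coord
  | annulus => Pole.zero.coord

theorem Piece.isOpenEmbedding_coord (c : Piece) : IsOpenEmbedding c.coord := by
  cases c with
  | disc e => exact e.isOpenEmbedding_coord
  | annulus => exact Pole.zero.isOpenEmbedding_coord

namespace ToricData

variable (T : ToricData)

theorem differentiableOn_poleMap (e : Pole) :
    DifferentiableOn ℂ (poleMap T.φ e) (ball 0 T.r) := by
  cases e with
  | zero => exact T.holomorphic
  | infty =>
    rw [differentiableOn_pi]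
    intro j z hz
    have hz' : -conj z ∈ ball (0 : ℂ) T.r := by simpa using hz
    have h1 : DifferentiableAt ℂ (fun w => T.φ w j) (-conj z) :=
      differentiableAt_pi.1 (T.holomorphic.differentiableAt (isOpen_ball.mem_nhds hz')) j
    have h2 : DifferentiableAt ℂ (fun w => T.φ (-w) j) (conj z) :=
      DifferentiableAt.comp (conj z) h1 differentiableAt_id.neg
    have h3 := h2.conj_conj
    rw [Complex.conj_conj] at h3
    exact h3.differentiableWithinAt

/-- The domain of the coordinates `(z, v)` of a piece. -/
def domain : Piece → Set Model
  | Piece.disc _ => {x | ‖x.1‖ < T.r ∧ x.2 ∈ T.U}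
  | Piece.annulus => {x | (T.r / 2 < ‖x.1‖ ∧ ‖x.1‖ < 2 / T.r) ∧ x.2 ∈ T.U}

/-- The local coordinates of the twistor space in terms of the coordinates `(z, v)` of a piece:
`(z², v + φ z / 2)` on the disc pieces (these functions are invariant under the identifications
and separate the classes), and `(z, v)` itself on the annulus piece. -/
def localCoord : Piece → Model → Model
  | Piece.disc e => fun x => (x.1 ^ 2, x.2 + (1 / 2 : ℂ) • poleMap T.φ e x.1)
  | Piece.annulus => fun x => x

theorem isOpen_domain (c : Piece) : IsOpen (T.domain c) := by
  cases c with
  | disc e =>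
    exact (isOpen_lt continuous_fst.norm continuous_const).inter
      (T.isOpen_U.preimage continuous_snd)
  | annulus =>
    exact ((isOpen_lt continuous_const continuous_fst.norm).inter
      (isOpen_lt continuous_fst.norm continuous_const)).inter
      (T.isOpen_U.preimage continuous_snd)

theorem snd_mem_of_mem_domain {c : Piece} {x : Model} (hx : x ∈ T.domain c) : x.2 ∈ T.U := by
  cases c with
  | disc e => exact hx.2
  | annulus => exact hx.2

instance (c : Piece) : Nonempty (T.domain c) := by
  have h0 := T.r_pos
  have h1 := T.r_lt_one
  cases c with
  | disc e => exact ⟨⟨(0, 0), by simpa [domain] using ⟨h0, T.zero_mem_U⟩⟩⟩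
  | annulus =>
    refine ⟨⟨(1, 0), ⟨⟨?_, ?_⟩, T.zero_mem_U⟩⟩⟩
    · simp only [norm_one]; linarith
    · simp only [norm_one]; rw [lt_div_iff₀ h0]; linarith

/-- A piece before passing to the quotient. -/
def pieceMap (c : Piece) (x : T.domain c) : T.Pre :=
  ⟨(c.coord x.1.1, x.1.2), T.snd_mem_of_mem_domain x.2⟩

theorem isOpenEmbedding_pieceMap (c : Piece) : IsOpenEmbedding (T.pieceMap c) := by
  have hU : IsOpen {p : OnePoint ℂ × (Fin 2 → ℂ) | p.2 ∈ T.U} :=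
    T.isOpen_U.preimage continuous_snd
  have h1 : IsOpenEmbedding (fun x : T.domain c =>
      ((c.coord x.1.1, x.1.2) : OnePoint ℂ × (Fin 2 → ℂ))) :=
    (c.isOpenEmbedding_coord.prodMap IsOpenEmbedding.id).comp
      (T.isOpen_domain c).isOpenEmbedding_subtypeVal
  exact IsOpenEmbedding.of_comp (T.pieceMap c) hU.isOpenEmbedding_subtypeVal h1

theorem continuousOn_localCoord (c : Piece) : ContinuousOn (T.localCoord c) (T.domain c) := by
  cases c with
  | disc e =>
    refine ContinuousOn.prodMk (continuous_fst.pow 2).continuousOn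
      (continuous_snd.continuousOn.add (ContinuousOn.fun_const_smul ?_ _))
    exact (T.differentiableOn_poleMap e).continuousOn.comp continuousOn_fst
      fun x hx => by simpa using hx.1
  | annulus => exact continuousOn_id

theorem isOpenMap_proj : IsOpenMap T.proj := by
  intro O hO
  have key : T.proj ⁻¹' (T.proj '' O) = O ∪ ⋃ e : Pole, T.pieceMap (Piece.disc e) ''
      {x | ∃ h : x.1.2 + poleMap T.φ e x.1.1 ∈ T.U,
        (⟨(e.coord (-x.1.1), x.1.2 + poleMap T.φ e x.1.1), h⟩ : T.Pre) ∈ O} := by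
    ext y
    constructor
    · rintro ⟨x, hx, hxy⟩
      rcases T.proj_eq_iff.1 hxy.symm with h | ⟨e, z, hz, h1, h2, h3⟩
      · exact Or.inl (h ▸ hx)
      · refine Or.inr (mem_iUnion.2 ⟨e, ⟨⟨(z, y.1.2), hz, y.2⟩, ⟨?_, ?_⟩, ?_⟩⟩)
        · exact h3 ▸ x.2
        · have hx' : (⟨(e.coord (-z), y.1.2 + poleMap T.φ e z), h3 ▸ x.2⟩ : T.Pre) = x :=
            Subtype.ext (Prod.ext h2.symm h3.symm)
          exact hx'.symm ▸ hx
        · exact Subtype.ext (Prod.ext h1.symm rfl)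
    · rintro (h | h)
      · exact ⟨y, h, rfl⟩
      · obtain ⟨e, x, ⟨h, hO'⟩, rfl⟩ := mem_iUnion.1 h
        refine ⟨_, hO', (T.proj_eq_iff.2 (Or.inr ⟨e, x.1.1, x.2.1, rfl, rfl, rfl⟩)).symm⟩
  have h2 : IsOpen (T.proj ⁻¹' (T.proj '' O)) := by
    rw [key]
    refine hO.union (isOpen_iUnion fun e => (T.isOpenEmbedding_pieceMap _).isOpenMap _ ?_)
    obtain ⟨O', hO', rfl⟩ := isOpen_induced_iff.1 hO
    have hc : Continuous fun x : T.domain (Piece.disc e) => poleMap T.φ e x.1.1 := by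
      have := (T.differentiableOn_poleMap e).continuousOn
      rw [continuousOn_iff_continuous_domRestrict] at this
      exact this.comp (f := fun x : T.domain (Piece.disc e) =>
        (⟨x.1.1, by simpa using x.2.1⟩ : ball (0 : ℂ) T.r)) (by fun_prop)
    have hc2 : Continuous fun x : T.domain (Piece.disc e) =>
        ((e.coord (-x.1.1), x.1.2 + poleMap T.φ e x.1.1) : OnePoint ℂ × (Fin 2 → ℂ)) :=
      (e.isOpenEmbedding_coord.continuous.comp (by fun_prop)).prodMk
        ((by fun_prop : Continuous fun x : T.domain (Piece.disc e) => x.1.2).add hc)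
    have : {x : T.domain (Piece.disc e) | ∃ h : x.1.2 + poleMap T.φ e x.1.1 ∈ T.U,
        (⟨(e.coord (-x.1.1), x.1.2 + poleMap T.φ e x.1.1), h⟩ : T.Pre) ∈ Subtype.val ⁻¹' O'} =
        (fun x : T.domain (Piece.disc e) =>
        ((e.coord (-x.1.1), x.1.2 + poleMap T.φ e x.1.1) : OnePoint ℂ × (Fin 2 → ℂ))) ⁻¹'
        ({p | p.2 ∈ T.U} ∩ O') := by
      ext x
      exact ⟨fun ⟨h, h'⟩ => ⟨h, h'⟩, fun ⟨h, h'⟩ => ⟨h, h'⟩⟩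
    rw [this]
    exact ((T.isOpen_U.preimage continuous_snd).inter hO').preimage hc2
  exact isQuotientMap_quotient_mk'.isOpen_preimage.1 h2

theorem isOpenMap_localCoord (c : Piece) :
    IsOpenMap ((T.domain c).domRestrict (T.localCoord c)) := by
  cases c with
  | annulus => exact (T.isOpen_domain _).isOpenMap_subtype_val
  | disc e =>
    intro O hO
    have hO1 : IsOpen (Subtype.val '' O) := (T.isOpen_domain _).isOpenMap_subtype_val _ hO
    have hsub : ∀ x ∈ Subtype.val '' O, ‖x.1‖ < T.r := by
      rintro _ ⟨x, -, rfl⟩; exact x.2.1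
    set O' : Set Model := Subtype.val '' O with hO'
    set S : Set Model := {y | ‖y.1‖ < T.r} with hS
    have hSo : IsOpen S := isOpen_lt continuous_fst.norm continuous_const
    have hcont : ContinuousOn
        (fun y : Model => (y.1, y.2 - (1 / 2 : ℂ) • poleMap T.φ e y.1)) S := by
      refine ContinuousOn.prodMk continuous_fst.continuousOn
        (continuous_snd.continuousOn.sub (ContinuousOn.fun_const_smul ?_ _))
      exact (T.differentiableOn_poleMap e).continuousOn.comp continuousOn_fst
        fun x hx => by simpa [hS] using hx
    have h1 := hcont.isOpen_inter_preimage hSo hO1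
    have h2 : IsOpenMap (Prod.map (fun z : ℂ => z ^ 2) (id : (Fin 2 → ℂ) → _)) :=
      (Complex.isOpenQuotientMap_pow 2).isOpenMap.prodMap IsOpenMap.id
    have h3 := h2 _ h1
    convert h3 using 1
    ext y
    constructor
    · rintro ⟨x, hx, rfl⟩
      refine ⟨(x.1.1, x.1.2 + (1 / 2 : ℂ) • poleMap T.φ e x.1.1), ⟨x.2.1, ?_⟩, rfl⟩
      simpa using ⟨x, hx, rfl⟩
    · rintro ⟨w, ⟨hw, x, hx, hxw⟩, rfl⟩
      refine ⟨x, hx, ?_⟩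
      have e1 : x.1.1 = w.1 := by rw [hxw]
      have e2 : x.1.2 = w.2 - (1 / 2 : ℂ) • poleMap T.φ e w.1 := by rw [hxw]
      simp [localCoord, e1, e2, Prod.map]

theorem eq_or_eq_neg_of_pole {e e' : Pole} {z w : ℂ} (hz : ‖z‖ < 1) (hw : ‖w‖ < 1)
    (h : e.coord z = e'.coord w) : e = e' ∧ z = w := by
  obtain rfl := Pole.coord_eq_of_norm_lt_one hz hw h
  exact ⟨rfl, e.coord_injective h⟩

theorem norm_lt_of_coord {e : Pole} {z w : ℂ} (h : Pole.zero.coord z = e.coord w)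
    (hz : T.r / 2 < ‖z‖ ∧ ‖z‖ < 2 / T.r) : T.r / 2 < ‖w‖ := by
  have h0 := T.r_pos
  cases e with
  | zero =>
    have := Pole.zero.coord_injective h
    exact this ▸ hz.1
  | infty =>
    by_cases hw : w = 0
    · simp [Pole.coord, hw] at h
    · simp only [Pole.coord, hw, if_false, OnePoint.coe_eq_coe] at h
      have h2 := hz.2
      rw [h, norm_inv, inv_lt_comm₀ (norm_pos_iff.2 hw) (by positivity), inv_div] at h2
      exact h2

theorem fibres_eq (c : Piece) (x y : T.domain c) :
    T.proj (T.pieceMap c x) = T.proj (T.pieceMap c y) ↔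
      (T.domain c).domRestrict (T.localCoord c) x = (T.domain c).domRestrict (T.localCoord c) y := by
  rw [T.proj_eq_iff]
  have hr := T.r_lt_one
  cases c with
  | annulus =>
    simp only [domRestrict_apply, localCoord]
    constructor
    · rintro (h | ⟨e, z, hz, h1, h2, h3⟩)
      · exact congrArg Subtype.val ((T.isOpenEmbedding_pieceMap _).injective h)
      · exfalso
        have hz2 := T.norm_lt_of_coord h1 x.2.1
        have h4 := T.separated e z hz2 hz x.1.2 x.2.2
        exact h4 (h3 ▸ y.2.2)
    · intro h
      exact Or.inl (by rw [Subtype.ext h])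
  | disc e =>
    simp only [domRestrict_apply, localCoord]
    constructor
    · rintro (h | ⟨e', z, hz, h1, h2, h3⟩)
      · rw [(T.isOpenEmbedding_pieceMap _).injective h]
      · obtain ⟨rfl, h1'⟩ := eq_or_eq_neg_of_pole (x.2.1.trans hr) (hz.trans hr) h1
        have h2' : y.1.1 = -z := e.coord_injective h2
        have h3' : y.1.2 = x.1.2 + poleMap T.φ e z := h3
        rw [h1', h2', h3', T.poleMap_neg e hz]
        refine Prod.ext (by simp) ?_
        funext j
        simp only [Pi.add_apply, Pi.smul_apply, Pi.neg_apply, smul_eq_mul]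
        ring
    · intro h
      have h1 : x.1.1 ^ 2 = y.1.1 ^ 2 := congrArg Prod.fst h
      have h2 : x.1.2 + (1 / 2 : ℂ) • poleMap T.φ e x.1.1 =
        y.1.2 + (1 / 2 : ℂ) • poleMap T.φ e y.1.1 := congrArg Prod.snd h
      rcases sq_eq_sq_iff_eq_or_eq_neg.1 h1 with h1 | h1
      · rw [h1] at h2
        left
        rw [show x = y from Subtype.ext (Prod.ext h1 (add_right_cancel h2))]
      · refine Or.inr ⟨e, x.1.1, x.2.1, rfl, ?_, ?_⟩
        · rw [h1, neg_neg]; rfl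
        · rw [show y.1.1 = -x.1.1 by rw [h1, neg_neg], T.poleMap_neg e x.2.1] at h2
          change y.1.2 = x.1.2 + poleMap T.φ e x.1.1
          funext j
          have := congrFun h2 j
          simp only [Pi.add_apply, Pi.smul_apply, Pi.neg_apply, smul_eq_mul] at this ⊢
          linear_combination -this

/-- The chart of the twistor space on a piece; it sends `[z, v]` to `localCoord c (z, v)`. -/
def pieceChart (c : Piece) : OpenPartialHomeomorph T.Z Model :=
  homeoOfFibres (fun x => T.proj (T.pieceMap c x)) ((T.domain c).domRestrict (T.localCoord c))
    (T.continuous_proj.comp (T.isOpenEmbedding_pieceMap c).continuous)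
    (continuousOn_iff_continuous_domRestrict.1 (T.continuousOn_localCoord c))
    (T.isOpenMap_proj.comp (T.isOpenEmbedding_pieceMap c).isOpenMap)
    (T.isOpenMap_localCoord c) (T.fibres_eq c)

theorem pieceChart_source (c : Piece) :
    (T.pieceChart c).source = range fun x => T.proj (T.pieceMap c x) := rfl

theorem pieceChart_apply (c : Piece) (x : T.domain c) :
    T.pieceChart c (T.proj (T.pieceMap c x)) = T.localCoord c x.1 :=
  homeoOfFibres_apply _ _ _ _ _ _ _ x

theorem exists_mem_source (p : T.Z) : ∃ c, p ∈ (T.pieceChart c).source := by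
  have h0 := T.r_pos
  obtain ⟨⟨⟨z, v⟩, hv⟩, rfl⟩ := Quotient.exists_rep p
  induction z using OnePoint.rec with
  | infty =>
    refine ⟨Piece.disc Pole.infty, ⟨⟨(0, v), by simpa using h0, hv⟩, ?_⟩⟩
    exact congrArg T.proj (Subtype.ext (Prod.ext (by simp [pieceMap, Piece.coord, Pole.coord]) rfl))
  | coe z =>
    by_cases h1 : ‖z‖ < T.r
    · exact ⟨Piece.disc Pole.zero, ⟨⟨(z, v), h1, hv⟩, rfl⟩⟩
    by_cases h2 : ‖z‖ < 2 / T.r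
    · exact ⟨Piece.annulus, ⟨⟨(z, v), ⟨by linarith [not_lt.1 h1], h2⟩, hv⟩, rfl⟩⟩
    · have hz : 0 < ‖z‖ := lt_of_lt_of_le (by positivity) (not_lt.1 h2)
      refine ⟨Piece.disc Pole.infty, ⟨⟨(z⁻¹, v), ?_, hv⟩, ?_⟩⟩
      · simp only [norm_inv]
        rw [inv_lt_comm₀ hz h0]
        refine lt_of_lt_of_le ?_ (not_lt.1 h2)
        rw [inv_eq_one_div]
        gcongr
        norm_num
      · refine congrArg T.proj (Subtype.ext (Prod.ext ?_ rfl))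
        simp [pieceMap, Piece.coord, Pole.coord, norm_pos_iff.1 hz]

instance : ChartedSpace Model T.Z where
  atlas := range T.pieceChart
  chartAt p := T.pieceChart (T.exists_mem_source p).choose
  mem_chart_source p := (T.exists_mem_source p).choose_spec
  chart_mem_atlas _ := mem_range_self _

theorem exists_equiv_hasFDerivAt {g : ℂ → ℂ} {h : ℂ → Fin 2 → ℂ} {x : Model} {a : ℂ}
    {b : Fin 2 → ℂ} (hg : HasDerivAt g a x.1) (hh : HasDerivAt h b x.1) (ha : a ≠ 0) :
    ∃ L : Model ≃L[ℂ] Model,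
      HasFDerivAt (fun y : Model => (g y.1, y.2 + h y.1)) (L : Model →L[ℂ] Model) x := by
  let f1 : Model →L[ℂ] ℂ := ContinuousLinearMap.fst ℂ ℂ (Fin 2 → ℂ)
  let f2 : Model →L[ℂ] (Fin 2 → ℂ) := ContinuousLinearMap.snd ℂ ℂ (Fin 2 → ℂ)
  refine ⟨ContinuousLinearEquiv.equivOfInverse ((f1.smulRight a).prod (f2 + f1.smulRight b))
    ((f1.smulRight a⁻¹).prod (f2 - f1.smulRight (a⁻¹ • b))) ?_ ?_, ?_⟩
  · intro y
    refine Prod.ext ?_ ?_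
    · simp [f1, ha]
    · simp [f1, f2, smul_smul, ha]
  · intro y
    refine Prod.ext ?_ ?_
    · simp [f1, ha]
    · simp [f1, f2, smul_smul]
  · have h1 : HasFDerivAt (fun y : Model => g y.1) (f1.smulRight a) x := by
      have := hg.hasFDerivAt.comp x (hasFDerivAt_fst (𝕜 := ℂ) (p := x))
      refine this.congr_fderiv ?_
      ext <;> simp [f1]
    have h2 : HasFDerivAt (fun y : Model => h y.1) (f1.smulRight b) x := by
      have := hh.hasFDerivAt.comp x (hasFDerivAt_fst (𝕜 := ℂ) (p := x))
      refine this.congr_fderiv ?_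
      ext <;> simp [f1]
    exact h1.prodMk ((hasFDerivAt_snd (𝕜 := ℂ) (p := x)).add h2)

/-- The coordinate centred at a pole as a function of the coordinate `z`. -/
def poleCoord : Pole → ℂ → ℂ
  | Pole.zero => fun z => z
  | Pole.infty => fun z => z⁻¹

theorem eq_poleCoord {e : Pole} {z w : ℂ} (h : Pole.zero.coord z = e.coord w) :
    w = poleCoord e z := by
  cases e with
  | zero => exact (Pole.zero.coord_injective h).symm
  | infty =>
    by_cases hw : w = 0
    · simp [Pole.coord, hw] at h
    · simp only [Pole.coord, hw, if_false, OnePoint.coe_eq_coe] at h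
      simp [poleCoord, h]

theorem poleCoord_ne_zero (e : Pole) {z : ℂ} (hz : z ≠ 0) : poleCoord e z ≠ 0 := by
  cases e with
  | zero => exact hz
  | infty => exact inv_ne_zero hz

theorem analyticAt_poleCoord (e : Pole) {z : ℂ} (hz : z ≠ 0) : AnalyticAt ℂ (poleCoord e) z := by
  cases e with
  | zero => exact analyticAt_id
  | infty => exact analyticAt_inv hz

theorem deriv_poleCoord_ne_zero (e : Pole) {z : ℂ} (hz : z ≠ 0) :
    deriv (poleCoord e) z ≠ 0 := by
  cases e with
  | zero =>
    have : deriv (poleCoord Pole.zero) z = 1 := deriv_id z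
    simp [this]
  | infty =>
    have : deriv (poleCoord Pole.infty) z = -(z ^ 2)⁻¹ := deriv_inv
    simp [this, hz]

/-- Where the chart of a disc piece meets that of the annulus piece. -/
theorem mem_overlap {e : Pole} {x : Model} (hx : x ∈ T.domain Piece.annulus)
    (h : (T.pieceChart Piece.annulus).symm x ∈ (T.pieceChart (Piece.disc e)).source) :
    ‖poleCoord e x.1‖ < T.r ∧ T.pieceChart (Piece.disc e) ((T.pieceChart Piece.annulus).symm x) =
      T.localCoord (Piece.disc e) (poleCoord e x.1, x.2) := by
  have hsymm : (T.pieceChart Piece.annulus).symm x = T.proj (T.pieceMap Piece.annulus ⟨x, hx⟩) := by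
    have h1 := T.pieceChart_apply Piece.annulus ⟨x, hx⟩
    have h2 := (T.pieceChart Piece.annulus).left_inv
      (x := T.proj (T.pieceMap Piece.annulus ⟨x, hx⟩)) ⟨_, rfl⟩
    rw [h1] at h2
    exact h2
  rw [hsymm] at h ⊢
  obtain ⟨y, hy⟩ := h
  change T.proj _ = T.proj _ at hy
  have key : y.1 = (poleCoord e x.1, x.2) := by
    rcases T.proj_eq_iff.1 hy.symm with h | ⟨e', z, hz, h1, h2, h3⟩
    · have h1 : Pole.zero.coord x.1 = e.coord y.1.1 := congrArg (fun p : T.Pre => p.1.1) h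
      have h2 : x.2 = y.1.2 := congrArg (fun p : T.Pre => p.1.2) h
      exact Prod.ext (eq_poleCoord h1) h2.symm
    · exfalso
      have hz2 := T.norm_lt_of_coord h1 hx.1
      exact T.separated e' z hz2 hz x.2 hx.2 (h3 ▸ y.2.2)
  refine ⟨?_, ?_⟩
  · have := y.2.1
    rwa [key] at this
  · rw [← hy, T.pieceChart_apply, key]

theorem analyticAt_poleMap (e : Pole) {z : ℂ} (hz : ‖z‖ < T.r) :
    AnalyticAt ℂ (poleMap T.φ e) z :=
  (T.differentiableOn_poleMap e).analyticAt (isOpen_ball.mem_nhds (by simpa using hz))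

theorem ne_zero_of_mem_annulus {x : Model} (hx : x ∈ T.domain Piece.annulus) : x.1 ≠ 0 := by
  have h0 := T.r_pos
  have h1 := hx.1.1
  exact norm_pos_iff.1 (by linarith)

theorem analyticAt_transition {e : Pole} {x : Model} (hx : x ∈ T.domain Piece.annulus)
    (hr : ‖poleCoord e x.1‖ < T.r) :
    AnalyticAt ℂ (fun y : Model => T.localCoord (Piece.disc e) (poleCoord e y.1, y.2)) x := by
  have h1 := analyticAt_poleCoord e (T.ne_zero_of_mem_annulus hx)
  have hfst : AnalyticAt ℂ (fun y : Model => y.1) x := analyticAt_fst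
  have h2 : AnalyticAt ℂ (fun y : Model => poleCoord e y.1) x := h1.comp hfst
  have h3 : AnalyticAt ℂ (fun y : Model => poleMap T.φ e (poleCoord e y.1)) x :=
    AnalyticAt.fun_comp (T.analyticAt_poleMap e hr) h2
  exact (h2.pow 2).prod (analyticAt_snd.add (analyticAt_const.fun_smul h3))

theorem exists_equiv_transition {e : Pole} {x : Model} (hx : x ∈ T.domain Piece.annulus)
    (hr : ‖poleCoord e x.1‖ < T.r) :
    ∃ L : Model ≃L[ℂ] Model, HasFDerivAt
      (fun y : Model => T.localCoord (Piece.disc e) (poleCoord e y.1, y.2))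
      (L : Model →L[ℂ] Model) x := by
  have h0 := T.ne_zero_of_mem_annulus hx
  have h1 := (analyticAt_poleCoord e h0).differentiableAt.hasDerivAt
  have h2 : HasDerivAt (fun z => (1 / 2 : ℂ) • poleMap T.φ e (poleCoord e z)) _ x.1 :=
    (((T.analyticAt_poleMap e hr).fun_comp (analyticAt_poleCoord e h0)).differentiableAt.const_smul
      (1 / 2 : ℂ)).hasDerivAt
  refine exists_equiv_hasFDerivAt (h1.fun_pow 2) h2 ?_
  simpa using ⟨poleCoord_ne_zero e h0, deriv_poleCoord_ne_zero e h0⟩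

theorem mem_of_mem_transition {e : Pole} {x : Model}
    (hx : x ∈ ((T.pieceChart Piece.annulus).symm ≫ₕ T.pieceChart (Piece.disc e)).source) :
    x ∈ T.domain Piece.annulus ∧
      (T.pieceChart Piece.annulus).symm x ∈ (T.pieceChart (Piece.disc e)).source := by
  rw [OpenPartialHomeomorph.trans_source] at hx
  obtain ⟨⟨y, rfl⟩, h2⟩ := hx
  exact ⟨y.2, h2⟩

theorem transition_eventuallyEq {e : Pole} {x : Model}
    (hx : x ∈ ((T.pieceChart Piece.annulus).symm ≫ₕ T.pieceChart (Piece.disc e)).source) :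
    ((T.pieceChart Piece.annulus).symm ≫ₕ T.pieceChart (Piece.disc e) : Model → Model) =ᶠ[𝓝 x]
      fun y : Model => T.localCoord (Piece.disc e) (poleCoord e y.1, y.2) := by
  filter_upwards [(OpenPartialHomeomorph.open_source _).mem_nhds hx] with y hy
  obtain ⟨h1, h2⟩ := T.mem_of_mem_transition hy
  exact (T.mem_overlap h1 h2).2

theorem disjoint_disc_source {e e' : Pole} (h : e ≠ e') {p : T.Z}
    (hp : p ∈ (T.pieceChart (Piece.disc e)).source)
    (hp' : p ∈ (T.pieceChart (Piece.disc e')).source) : False := by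
  have hr := T.r_lt_one
  obtain ⟨x, rfl⟩ := hp
  obtain ⟨y, hy⟩ := hp'
  change T.proj _ = T.proj _ at hy
  apply h
  rcases T.proj_eq_iff.1 hy.symm with h1 | ⟨e'', z, hz, h1, h2, -⟩
  · exact (eq_or_eq_neg_of_pole (x.2.1.trans hr) (y.2.1.trans hr)
      (congrArg (fun p : T.Pre => p.1.1) h1)).1
  · have a1 := (eq_or_eq_neg_of_pole (x.2.1.trans hr) (hz.trans hr) h1).1
    have a2 := (eq_or_eq_neg_of_pole (y.2.1.trans hr)
      (by simpa using hz.trans hr : ‖-z‖ < 1) h2).1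
    exact a1.trans a2.symm

theorem contDiffOn_transition (c c' : Piece) :
    ContDiffOn ℂ ω ((T.pieceChart c).symm ≫ₕ T.pieceChart c')
      ((T.pieceChart c).symm ≫ₕ T.pieceChart c').source := by
  have hself : ∀ c, ContDiffOn ℂ ω ((T.pieceChart c).symm ≫ₕ T.pieceChart c)
      ((T.pieceChart c).symm ≫ₕ T.pieceChart c).source := fun c =>
    contDiffOn_id.congr fun x hx => (T.pieceChart c).right_inv
      (by rw [OpenPartialHomeomorph.trans_source] at hx; exact hx.1)
  cases c with
  | annulus =>
    cases c' with
    | annulus => exact hself _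
    | disc e =>
      intro x hx
      obtain ⟨h1, h2⟩ := T.mem_of_mem_transition hx
      exact ((T.analyticAt_transition h1 (T.mem_overlap h1 h2).1).contDiffAt.congr_of_eventuallyEq
        (T.transition_eventuallyEq hx)).contDiffWithinAt
  | disc e =>
    cases c' with
    | annulus =>
      intro a ha
      set t := (T.pieceChart Piece.annulus).symm ≫ₕ T.pieceChart (Piece.disc e) with ht
      have hts : (T.pieceChart (Piece.disc e)).symm ≫ₕ T.pieceChart Piece.annulus = t.symm := by
        rw [ht, OpenPartialHomeomorph.trans_symm_eq_symm_trans_symm,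
          OpenPartialHomeomorph.symm_symm]
      rw [hts] at ha ⊢
      have hx : t.symm a ∈ t.source := t.map_target ha
      obtain ⟨h1, h2⟩ := T.mem_of_mem_transition hx
      have h3 := (T.mem_overlap h1 h2).1
      obtain ⟨L, hL⟩ := T.exists_equiv_transition h1 h3
      have heq := T.transition_eventuallyEq hx
      exact (t.contDiffAt_symm ha (hL.congr_of_eventuallyEq heq)
        ((T.analyticAt_transition h1 h3).contDiffAt.congr_of_eventuallyEq heq)).contDiffWithinAt
    | disc e' =>
      by_cases h : e = e'
      · subst h; exact hself _
      · intro x hx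
        rw [OpenPartialHomeomorph.trans_source] at hx
        exact (T.disjoint_disc_source h ((T.pieceChart (Piece.disc e)).map_target hx.1) hx.2).elim

/-- The twistor space is a complex manifold. -/
instance : IsManifold 𝓘(ℂ, Model) ω T.Z := by
  refine isManifold_of_contDiffOn _ _ _ ?_
  rintro _ _ ⟨c, rfl⟩ ⟨c', rfl⟩
  simpa using T.contDiffOn_transition c c'

/-- The twistor space is Hausdorff. -/
instance : T2Space T.Z := by
  have hq : IsOpenQuotientMap T.proj :=
    ⟨Quotient.mk_surjective, T.continuous_proj, T.isOpenMap_proj⟩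
  rw [t2Space_iff_of_isOpenQuotientMap hq]
  have h0 := T.r_pos
  let C : Pole → Set (closedBall (0 : ℂ) (T.r / 2) × (T.Pre × T.Pre)) := fun e =>
    {a | a.2.1.1.1 = e.coord a.1.1 ∧ a.2.2.1.1 = e.coord (-a.1.1) ∧
      a.2.2.1.2 = a.2.1.1.2 + poleMap T.φ e a.1.1}
  have hC : ∀ e, IsClosed (C e) := by
    intro e
    have h1 : Continuous fun a : closedBall (0 : ℂ) (T.r / 2) => poleMap T.φ e a.1 := by
      have h2 := (T.differentiableOn_poleMap e).continuousOn.mono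
        (closedBall_subset_ball (by linarith : T.r / 2 < T.r))
      exact continuousOn_iff_continuous_domRestrict.1 h2
    have hc := e.isOpenEmbedding_coord.continuous
    refine (isClosed_eq (by fun_prop) (hc.comp (by fun_prop))).inter
      ((isClosed_eq (by fun_prop) (hc.comp (by fun_prop))).inter (isClosed_eq (by fun_prop) ?_))
    exact Continuous.add (by fun_prop) (h1.comp continuous_fst)
  have key : {q : T.Pre × T.Pre | T.proj q.1 = T.proj q.2} =
      {q | q.1 = q.2} ∪ (Prod.snd '' C Pole.zero ∪ Prod.snd '' C Pole.infty) := by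
    ext ⟨x, y⟩
    constructor
    · intro h
      rcases T.proj_eq_iff.1 h with h | ⟨e, z, hz, h1, h2, h3⟩
      · exact Or.inl h
      · have hz' : ‖z‖ ≤ T.r / 2 := by
          by_contra hlt
          exact T.separated e z (not_le.1 hlt) hz x.1.2 x.2 (h3 ▸ y.2)
        have hmem : (x, y) ∈ Prod.snd '' C e :=
          ⟨(⟨z, by simpa using hz'⟩, (x, y)), ⟨h1, h2, h3⟩, rfl⟩
        cases e with
        | zero => exact Or.inr (Or.inl hmem)
        | infty => exact Or.inr (Or.inr hmem)
    · have hback : ∀ e, (x, y) ∈ Prod.snd '' C e → T.proj x = T.proj y := by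
        rintro e ⟨⟨z, q⟩, ⟨h1, h2, h3⟩, h⟩
        obtain rfl : q = (x, y) := h
        have hz : ‖z.1‖ ≤ T.r / 2 := mem_closedBall_zero_iff.1 z.2
        exact T.proj_eq_iff.2 (Or.inr ⟨e, z.1, by linarith, h1, h2, h3⟩)
      rintro (h | h | h)
      · exact congrArg T.proj h
      · exact hback _ h
      · exact hback _ h
  rw [key]
  exact (isClosed_eq continuous_fst continuous_snd).union
    ((isClosedMap_snd_of_compactSpace _ (hC _)).union (isClosedMap_snd_of_compactSpace _ (hC _)))

end ToricData

/-! ### Square roots of the anticanonical bundle, and twisted one-forms -/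

section Twisted

variable (E : Type*) [NormedAddCommGroup E] [NormedSpace ℂ E]
  (M : Type*) [TopologicalSpace M] [ChartedSpace E M] [IsManifold 𝓘(ℂ, E) ω M]

/-- A square root `K^{-1/2}` of the anticanonical bundle `K⁻¹ = Λᵗᵒᵖ TM` of the complex
manifold `M`: a holomorphic line bundle `N`, given over the charts of `M` by transition functions,
together with a holomorphic isomorphism `N ⊗ N ≅ K⁻¹`. If `f_e` is the frame of `N` over the chart
`e`, the isomorphism sends `f_e ⊗ f_e` to `unit e • ∂₁ ∧ ⋯ ∧ ∂ₙ` in the coordinates `e`; the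
transition functions of `K⁻¹` are the Jacobian determinants of the changes of coordinates. -/
structure AnticanonicalRoot where
  /-- the line bundle `N` -/
  core : VectorBundleCore ℂ M ℂ (atlas E M)
  baseSet_eq : ∀ e, core.baseSet e = e.1.source
  isContMDiff : core.IsContMDiff 𝓘(ℂ, E) ω
  /-- the isomorphism `N ⊗ N ≅ K⁻¹` in the local frames -/
  unit : atlas E M → M → ℂ
  unit_ne_zero : ∀ e, ∀ p ∈ e.1.source, unit e p ≠ 0
  contMDiffOn_unit : ∀ e, ContMDiffOn 𝓘(ℂ, E) 𝓘(ℂ, ℂ) ω (unit e) e.1.source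
  sq_coordChange : ∀ e e' : atlas E M, ∀ p ∈ e.1.source ∩ e'.1.source,
    core.coordChange e e' p 1 ^ 2 * unit e' p =
      ((tangentBundleCore 𝓘(ℂ, E) M).coordChange e e' p).det * unit e p

attribute [instance] AnticanonicalRoot.isContMDiff

variable {E M}

instance (N : AnticanonicalRoot E M) (p : M) : IsTopologicalAddGroup (N.core.Fiber p) :=
  inferInstanceAs (IsTopologicalAddGroup ℂ)

instance (N : AnticanonicalRoot E M) (p : M) : ContinuousSMul ℂ (N.core.Fiber p) :=
  inferInstanceAs (ContinuousSMul ℂ ℂ)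

/-- Holomorphic sections of `T*M ⊗ N = Hom(TM, N)`. -/
abbrev TwistedForm (N : AnticanonicalRoot E M) : Type _ :=
  ContMDiffSection 𝓘(ℂ, E) (E →L[ℂ] ℂ) ω
    (fun p : M => TangentSpace 𝓘(ℂ, E) p →L[ℂ] N.core.Fiber p)

variable {N : AnticanonicalRoot E M}

/-- A section `θ` of `T*M ⊗ N` as an ordinary one-form `α` on the target of the chart `e`:
`θ = α ⊗ f_e` in the coordinates and the frame belonging to `e`. -/
def localForm (θ : TwistedForm N) (e : atlas E M) (x : E) : E →L[ℂ] ℂ :=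
  (N.core.coordChange (N.core.indexAt (e.1.symm x)) e (e.1.symm x)).comp
    (ContinuousLinearMap.comp (θ (e.1.symm x) : E →L[ℂ] ℂ)
      ((tangentBundleCore 𝓘(ℂ, E) M).coordChange e (achart E (e.1.symm x)) (e.1.symm x)))

/-- `θ` is a twisted holomorphic contact structure: it vanishes nowhere, and the hyperplane
distribution `ker θ` is maximally non-integrable, i.e. `dα` is non-degenerate on `ker α` for each
local expression `θ = α ⊗ f_e`, where `dα (X, Y) = (Dα X) Y - (Dα Y) X`. -/
def IsContact (θ : TwistedForm N) : Prop :=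
  ∀ (e : atlas E M), ∀ x ∈ e.1.target, localForm θ e x ≠ 0 ∧
    ∀ X : E, localForm θ e x X = 0 → X ≠ 0 → ∃ Y : E, localForm θ e x Y = 0 ∧
      fderiv ℂ (localForm θ e) x X Y - fderiv ℂ (localForm θ e) x Y X ≠ 0

/-- A vector field in the coordinates of the chart `e`. -/
def localField (X : ∀ p : M, TangentSpace 𝓘(ℂ, E) p) (e : atlas E M) (x : E) : E :=
  (tangentBundleCore 𝓘(ℂ, E) M).coordChange (achart E (e.1.symm x)) e (e.1.symm x)
    (X (e.1.symm x))

/-- The Lie derivative of a section `θ` of `T*M ⊗ N` along a vector field `X`, in the chart `e`.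
With `θ = α ⊗ f`, `f ⊗ f = h • ∂₁ ∧ ⋯ ∧ ∂ₙ` and the lift of the flow of `X` to `N` for which
`N ⊗ N ≅ K⁻¹` is equivariant one has `L_X f = (1 / 2) (D_X h / h - div X) f`, hence
`L_X θ = (D_X α + α ∘ DX + (1 / 2) (D_X h / h - div X) α) ⊗ f`. -/
def localLieDerivative (θ : TwistedForm N) (X : ∀ p : M, TangentSpace 𝓘(ℂ, E) p)
    (e : atlas E M) (x : E) : E →L[ℂ] ℂ :=
  fderiv ℂ (localForm θ e) x (localField X e x) +
    (localForm θ e x).comp (fderiv ℂ (localField X e) x) +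
    ((1 / 2 : ℂ) * (fderiv ℂ (fun y => N.unit e (e.1.symm y)) x (localField X e x) /
        N.unit e (e.1.symm x) -
      LinearMap.trace ℂ E (fderiv ℂ (localField X e) x).toLinearMap)) • localForm θ e x

/-- `θ` is invariant under the flow of `X`: its Lie derivative along `X` vanishes. -/
def IsInvariant (θ : TwistedForm N) (X : ∀ p : M, TangentSpace 𝓘(ℂ, E) p) : Prop :=
  ∀ (e : atlas E M), ∀ x ∈ e.1.target, localLieDerivative θ X e x = 0

/-- A map from the Riemann sphere to `M` is holomorphic. -/
def IsHolomorphicCurve (f : OnePoint ℂ → M) : Prop :=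
  ∀ e : Pole, ContMDiff 𝓘(ℂ, ℂ) 𝓘(ℂ, E) ω (fun z : ℂ => f (e.coord z))

/-- The restriction of `θ` to the curve `f`, a section of `T*ℙ¹ ⊗ f^*N`, has no zeros: `θ` does
not vanish on the velocity of `f` in the coordinate `z`, nor in the coordinate `1 / z`. -/
def NonzeroAlong (θ : TwistedForm N) (f : OnePoint ℂ → M) : Prop :=
  ∀ (e : Pole) (z : ℂ), θ (f (e.coord z))
    (mfderiv 𝓘(ℂ, ℂ) 𝓘(ℂ, E) (fun w : ℂ => f (e.coord w)) z (1 : ℂ)) ≠ 0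

end Twisted

namespace ToricData

variable (T : ToricData)

/-- The central twistor line `L = {[z, 0]}`. -/
def centralLine : C(OnePoint ℂ, T.Z) where
  toFun z := T.point z 0
  continuous_toFun := by
    simp only [T.point_of_mem _ T.zero_mem_U]
    exact T.continuous_proj.comp (by fun_prop)

/-- The vector field on the twistor space generated by `t ∈ ℂ²` under the (local) action
`t • [z, v] = [z, v + t]`: its value at `[z, v]` is the velocity at `s = 0` of `s ↦ [z, v + s t]`. -/
def actionField (t : Fin 2 → ℂ) (p : T.Z) : TangentSpace 𝓘(ℂ, Model) p :=
  let x : T.Pre := Quotient.out p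
  (mfderiv 𝓘(ℂ, ℂ) 𝓘(ℂ, Model) (fun s : ℂ => T.point x.1.1 (x.1.2 + s • t)) 0 (1 : ℂ) : Model)

end ToricData

/-- The quadratic polynomials of the form `a z² + b`. -/
def evenQuadratics : Submodule ℂ ℂ[X] := Submodule.span ℂ {Polynomial.X ^ 2, 1}

end ToricTwistor

/-!
On the annulus piece, with coordinates `(z, v)`, the contact form is `θ = dz + q₁ dv₁ + q₂ dv₂`. Its
coefficients do not depend on `v`, hence it is invariant under translations; it is `dz` on the
central line `v = 0`; and with `q_j = a_j z² + b_j` one has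
`θ ∧ dθ = 2 z (a₁ b₂ - a₂ b₁) dv₁ ∧ dz ∧ dv₂` up to sign, which is non-zero on the annulus because
`q₁, q₂` is a basis.

Near `z = 0` the coordinates of the quotient are `s = z²` and `w = v + φ z / 2`. There
`θ = (1 - (q₁ φ₁' + q₂ φ₂') / 2) dz + ∑ q_j dw_j`, and the hypothesis `q₁ φ₁' + q₂ φ₂' = 2` says
exactly that the first term vanishes, so that `θ = ∑ (a_j s + b_j) dw_j` extends
holomorphically over `s = 0` (`contactForm_compatible`); this is a contact form because the determinant of the coefficients is
non-zero. Near `z = ∞`, with `ζ = 1 / z`, the same computation applies to `ζ² θ` and yields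
`∑ (a_j + b_j ζ²) dw_j`. So `θ` takes values in the line bundle whose frames over the annulus and
over the disc at `∞` differ by `ζ²`, and comparison with the Jacobians of the coordinate changes
shows that this bundle is a square root of `K⁻¹` (`lineTransition_sq`).

Finally, holomorphic curves near the central line in the compact-open topology are uniformly close
to it in charts, hence so are their derivatives by the Weierstrass theorem, and `θ` remains non-zero
on velocities near each point of the line (`eventually_velocity_ne_zero`); the Riemann sphere is
compact, so finitely many such points suffice.
-/

namespace ToricTwistor

/-! ### Twisted one-forms in charts -/

section Charts

variable {E : Type*} [NormedAddCommGroup E] [NormedSpace ℂ E]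
  {M : Type*} [TopologicalSpace M] [ChartedSpace E M] [IsManifold 𝓘(ℂ, E) ω M]

theorem tangentCoordChange_eq_fderiv (e e' : atlas E M) (p : M) :
    (tangentBundleCore 𝓘(ℂ, E) M).coordChange e e' p =
      fderiv ℂ (fun x => e'.1 (e.1.symm x)) (e.1 p) := by
  rw [tangentBundleCore_coordChange]
  simp only [mfld_simps, fderivWithin_univ]
  rfl

theorem differentiableAt_transition (e e' : atlas E M) {p : M} (hp : p ∈ e.1.source)
    (hp' : p ∈ e'.1.source) : DifferentiableAt ℂ (fun x => e'.1 (e.1.symm x)) (e.1 p) := by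
  have h := (𝓘(ℂ, E)).contDiffWithinAt_extendCoordChange' (n := ω)
    (IsManifold.subset_maximalAtlas e.2) (IsManifold.subset_maximalAtlas e'.2) hp hp'
  simp only [mfld_simps] at h
  exact (contDiffWithinAt_univ.1 h).differentiableAt (by simp)

theorem differentiableAt_chart_comp (e e' : atlas E M) {g : ℂ → M} {z : ℂ}
    (hg : ContinuousAt g z) (hp : g z ∈ e.1.source) (hp' : g z ∈ e'.1.source)
    (hd : DifferentiableAt ℂ (fun w => e.1 (g w)) z) :
    DifferentiableAt ℂ (fun w => e'.1 (g w)) z := by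
  refine ((differentiableAt_transition e e' hp hp').comp z hd).congr_of_eventuallyEq ?_
  filter_upwards [hg (e.1.open_source.mem_nhds hp)] with w hw
  simp [e.1.left_inv hw]

/-- The transition functions of the tangent bundle carry the velocity of a curve in one chart to its
velocity in another. -/
theorem tangentCoordChange_velocity (e e' : atlas E M) {g : ℂ → M} {z : ℂ}
    (hg : ContinuousAt g z) (hp : g z ∈ e.1.source) (hp' : g z ∈ e'.1.source)
    (hd : DifferentiableAt ℂ (fun w => e.1 (g w)) z) :
    (tangentBundleCore 𝓘(ℂ, E) M).coordChange e e' (g z) (deriv (fun w => e.1 (g w)) z) =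
      deriv (fun w => e'.1 (g w)) z := by
  rw [tangentCoordChange_eq_fderiv,
    ← fderiv_comp_deriv z (differentiableAt_transition e e' hp hp') hd]
  refine EventuallyEq.deriv_eq ?_
  filter_upwards [hg (e.1.open_source.mem_nhds hp)] with w hw
  simp [e.1.left_inv hw]

omit [IsManifold 𝓘(ℂ, E) ω M] in
theorem mfderiv_eq_deriv_chart {g : ℂ → M} {z : ℂ} (hg : ContinuousAt g z)
    (hd : DifferentiableAt ℂ (fun w => (achart E (g z)).1 (g w)) z) :
    (mfderiv 𝓘(ℂ, ℂ) 𝓘(ℂ, E) g z (1 : ℂ) : E) =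
      deriv (fun w => (achart E (g z)).1 (g w)) z := by
  have hmd : MDifferentiableAt 𝓘(ℂ, ℂ) 𝓘(ℂ, E) g z := by
    rw [mdifferentiableAt_iff]
    refine ⟨hg, ?_⟩
    exact hd.differentiableWithinAt
  rw [hmd.mfderiv]
  change fderivWithin ℂ (fun w => (achart E (g z)).1 (g w)) (range (id : ℂ → ℂ)) z 1 = _
  rw [range_id, fderivWithin_univ, fderiv_apply_one_eq_deriv]

/-- The value of `θ` on a velocity vector, computed in an arbitrary chart. -/
theorem localForm_velocity {N : AnticanonicalRoot E M} (θ : TwistedForm N) (e : atlas E M)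
    {g : ℂ → M} {z : ℂ} (hg : ContinuousAt g z) (hp : g z ∈ e.1.source)
    (hd : DifferentiableAt ℂ (fun w => e.1 (g w)) z) :
    localForm θ e (e.1 (g z)) (deriv (fun w => e.1 (g w)) z) =
      N.core.coordChange (N.core.indexAt (g z)) e (g z)
        (θ (g z) (mfderiv 𝓘(ℂ, ℂ) 𝓘(ℂ, E) g z (1 : ℂ))) := by
  have h1 := mem_chart_source E (g z)
  have h2 := tangentCoordChange_velocity e (achart E (g z)) hg hp h1 hd
  rw [← mfderiv_eq_deriv_chart hg (differentiableAt_chart_comp e _ hg hp h1 hd)] at h2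
  unfold localForm
  rw [e.1.left_inv hp]
  change N.core.coordChange (N.core.indexAt (g z)) e (g z)
    ((θ (g z) : E →L[ℂ] ℂ) ((tangentBundleCore 𝓘(ℂ, E) M).coordChange e (achart E (g z)) (g z)
      (deriv (fun w => e.1 (g w)) z))) = _
  exact congrArg (fun v : E => N.core.coordChange (N.core.indexAt (g z)) e (g z)
    ((θ (g z) : E →L[ℂ] ℂ) v)) h2

/-- Local one-forms `α e` which transform like sections of `T*M ⊗ N` are the local expressions of a
section. -/
def TwistedForm.ofLocal (N : AnticanonicalRoot E M) (α : atlas E M → E → E →L[ℂ] ℂ)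
    (hα : ∀ e, ContDiffOn ℂ ω (α e) e.1.target)
    (h : ∀ e e' : atlas E M, ∀ p ∈ e.1.source ∩ e'.1.source,
      (N.core.coordChange e e' p).comp (α e (e.1 p)) =
        (α e' (e'.1 p)).comp ((tangentBundleCore 𝓘(ℂ, E) M).coordChange e e' p)) :
    TwistedForm N where
  toFun p := ((N.core.coordChange (achart E p) (N.core.indexAt p) p).comp
    (α (achart E p) (chartAt E p p)) : E →L[ℂ] ℂ)
  contMDiff_toFun := by
    intro p₀
    rw [contMDiffAt_hom_bundle]
    refine ⟨contMDiffAt_id, ?_⟩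
    have hmem : ∀ᶠ p in 𝓝 p₀, p ∈ (achart E p₀).1.source ∧
        p ∈ N.core.baseSet (N.core.indexAt p₀) :=
      Filter.Eventually.and ((achart E p₀).1.open_source.mem_nhds (mem_chart_source E p₀))
        ((N.core.isOpen_baseSet _).mem_nhds (N.core.mem_baseSet_at p₀))
    have h1 : ContMDiffAt 𝓘(ℂ, E) 𝓘(ℂ, E →L[ℂ] ℂ) ω (fun p : M =>
        (N.core.coordChange (achart E p₀) (N.core.indexAt p₀) p).comp
          (α (achart E p₀) (chartAt E p₀ p))) p₀ := by
      refine ContMDiffAt.clm_comp ?_ ?_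
      · refine (N.core.contMDiffOn_coordChange 𝓘(ℂ, E) (n := ω) (achart E p₀)
          (N.core.indexAt p₀)).contMDiffAt (inter_mem ?_ ?_)
        · rw [N.baseSet_eq]
          exact (achart E p₀).1.open_source.mem_nhds (mem_chart_source E p₀)
        · exact (N.core.isOpen_baseSet _).mem_nhds (N.core.mem_baseSet_at p₀)
      · have h2 : ContMDiffAt 𝓘(ℂ, E) 𝓘(ℂ, E) ω (chartAt E p₀) p₀ :=
          contMDiffAt_of_mem_maximalAtlas (IsManifold.chart_mem_maximalAtlas p₀)
            (mem_chart_source E p₀)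
        have h3 : ContMDiffAt 𝓘(ℂ, E) 𝓘(ℂ, E →L[ℂ] ℂ) ω (α (achart E p₀)) (chartAt E p₀ p₀) :=
          ((hα (achart E p₀)).contDiffAt
            ((achart E p₀).1.open_target.mem_nhds (mem_chart_target E p₀))).contMDiffAt
        exact h3.comp p₀ h2
    refine h1.congr_of_eventuallyEq ?_
    filter_upwards [hmem] with p hp
    have h4 := VectorBundleCore.inCoordinates_eq (tangentBundleCore 𝓘(ℂ, E) M) N.core
      (x₀ := p₀) (x := p) (y₀ := p₀) (y := p)
      ((N.core.coordChange (achart E p) (N.core.indexAt p) p).comp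
        (α (achart E p) (chartAt E p p)) : E →L[ℂ] ℂ) hp.1 hp.2
    refine h4.trans ?_
    have h5 := h (achart E p₀) (achart E p) p ⟨hp.1, mem_chart_source E p⟩
    have b1 : p ∈ N.core.baseSet (achart E p) := by
      rw [N.baseSet_eq]; exact mem_chart_source E p
    have b0 : p ∈ N.core.baseSet (achart E p₀) := by rw [N.baseSet_eq]; exact hp.1
    ext v
    have h6 := congrArg (fun l : E →L[ℂ] ℂ => l v) h5
    simp only [ContinuousLinearMap.comp_apply] at h6 ⊢
    have h7 : chartAt E p p = (achart E p).1 p := rfl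
    simp only [tangentBundleCore_indexAt]
    rw [h7, ← h6, N.core.coordChange_comp _ _ _ _ ⟨⟨b0, b1⟩, N.core.mem_baseSet_at p⟩,
      N.core.coordChange_comp _ _ _ _ ⟨⟨b0, N.core.mem_baseSet_at p⟩, hp.2⟩]
    rfl

theorem localForm_ofLocal (N : AnticanonicalRoot E M) (α : atlas E M → E → E →L[ℂ] ℂ)
    (hα : ∀ e, ContDiffOn ℂ ω (α e) e.1.target)
    (h : ∀ e e' : atlas E M, ∀ p ∈ e.1.source ∩ e'.1.source,
      (N.core.coordChange e e' p).comp (α e (e.1 p)) =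
        (α e' (e'.1 p)).comp ((tangentBundleCore 𝓘(ℂ, E) M).coordChange e e' p))
    (e : atlas E M) {x : E} (hx : x ∈ e.1.target) :
    localForm (TwistedForm.ofLocal N α hα h) e x = α e x := by
  unfold localForm
  set p := e.1.symm x with hp
  have hps : p ∈ e.1.source := e.1.map_target hx
  have hxp : e.1 p = x := e.1.right_inv hx
  have h5 := h e (achart E p) p ⟨hps, mem_chart_source E p⟩
  have b1 : p ∈ N.core.baseSet (achart E p) := by
    rw [N.baseSet_eq]; exact mem_chart_source E p
  have b0 : p ∈ N.core.baseSet e := by rw [N.baseSet_eq]; exact hps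
  ext v
  have h6 := congrArg (fun l : E →L[ℂ] ℂ => l v) h5
  simp only [ContinuousLinearMap.comp_apply] at h6
  change N.core.coordChange (N.core.indexAt p) e p
    (N.core.coordChange (achart E p) (N.core.indexAt p) p ((α (achart E p) ((achart E p).1 p))
      ((tangentBundleCore 𝓘(ℂ, E) M).coordChange e (achart E p) p v))) = _
  rw [← h6, N.core.coordChange_comp _ _ _ _ ⟨⟨b0, b1⟩, N.core.mem_baseSet_at p⟩,
    N.core.coordChange_comp _ _ _ _ ⟨⟨b0, N.core.mem_baseSet_at p⟩, b0⟩,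
    N.core.coordChange_self _ _ b0, hxp]

end Charts

/-! ### Curves near a given curve -/

section Curves

variable {E : Type*} [NormedAddCommGroup E] [NormedSpace ℂ E]
  {M : Type*} [TopologicalSpace M] [ChartedSpace E M] [IsManifold 𝓘(ℂ, E) ω M]

theorem IsHolomorphicCurve.differentiableAt_chart {f : OnePoint ℂ → M}
    (hf : IsHolomorphicCurve (E := E) f) (e : Pole) (c : atlas E M) {z : ℂ}
    (hz : f (e.coord z) ∈ c.1.source) : DifferentiableAt ℂ (fun w => c.1 (f (e.coord w))) z := by
  have h1 : ContMDiffAt 𝓘(ℂ, E) 𝓘(ℂ, E) ω c.1 (f (e.coord z)) :=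
    contMDiffAt_of_mem_maximalAtlas (IsManifold.subset_maximalAtlas c.2) hz
  exact (h1.comp z (hf e z)).contDiffAt.differentiableAt (by simp)

/-- If `θ` is non-zero on the velocity of a curve `γ` at a point, then it is non-zero on the
velocity of all holomorphic curves near `γ` at all nearby points: holomorphic curves which are
uniformly close have close derivatives. -/
theorem eventually_velocity_ne_zero [CompleteSpace E] {N : AnticanonicalRoot E M} (θ : TwistedForm N)
    (γ : C(OnePoint ℂ, M)) (hγ : IsHolomorphicCurve (E := E) γ) (e : Pole) (z₀ : ℂ)
    (c : atlas E M) (hc : ContinuousOn (localForm θ c) c.1.target)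
    (hz₀ : γ (e.coord z₀) ∈ c.1.source)
    (hne : localForm θ c (c.1 (γ (e.coord z₀))) (deriv (fun w => c.1 (γ (e.coord w))) z₀) ≠ 0) :
    ∀ᶠ y : C(OnePoint ℂ, M) × ℂ in 𝓝 (γ, z₀), IsHolomorphicCurve (E := E) y.1 →
      θ (y.1 (e.coord y.2)) (mfderiv 𝓘(ℂ, ℂ) 𝓘(ℂ, E) (fun w : ℂ => y.1 (e.coord w)) y.2 (1 : ℂ))
        ≠ 0 := by
  set H : Set C(OnePoint ℂ, M) := {f | IsHolomorphicCurve (E := E) f} with hH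
  let ev : C(OnePoint ℂ, M) × ℂ → M := fun y => y.1 (e.coord y.2)
  have hev : Continuous ev := by
    have := e.isOpenEmbedding_coord.continuous
    exact continuous_eval.comp (continuous_fst.prodMk (this.comp continuous_snd))
  let F : C(OnePoint ℂ, M) → ℂ → E := fun f w => c.1 (f (e.coord w))
  have hF : ∀ w, γ (e.coord w) ∈ c.1.source →
      Tendsto (fun y : C(OnePoint ℂ, M) × ℂ => F y.1 y.2) (𝓝 γ ×ˢ 𝓝 w) (𝓝 (F γ w)) := by
    intro w hw
    rw [← nhds_prod_eq]
    exact ((c.1.continuousAt hw).tendsto.comp (hev.tendsto (γ, w)) :)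
  have hV : IsOpen {w : ℂ | γ (e.coord w) ∈ c.1.source} :=
    c.1.open_source.preimage (γ.continuous.comp e.isOpenEmbedding_coord.continuous)
  obtain ⟨δ, hδ, hball⟩ := nhds_basis_closedBall.mem_iff.1 (hV.mem_nhds hz₀)
  have hmaps : ∀ᶠ f in 𝓝 γ, ∀ w ∈ closedBall z₀ δ, f (e.coord w) ∈ c.1.source := by
    refine (isCompact_closedBall z₀ δ).eventually_forall_of_forall_eventually fun w hw => ?_
    exact (hev.tendsto (γ, w)).eventually (c.1.open_source.mem_nhds (hball hw))
  have hdiff : ∀ᶠ f in 𝓝 γ ⊓ 𝓟 H, DifferentiableOn ℂ (F f) (ball z₀ δ) := by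
    rw [eventually_inf_principal]
    filter_upwards [hmaps] with f hf hfH w hw
    exact (hfH.differentiableAt_chart e c
      (hf w (ball_subset_closedBall hw))).differentiableWithinAt
  have hγd : DifferentiableOn ℂ (F γ) (ball z₀ δ) := fun w hw =>
    (hγ.differentiableAt_chart e c
      (hball (ball_subset_closedBall hw))).differentiableWithinAt
  have hloc : TendstoLocallyUniformlyOn F (F γ) (𝓝 γ ⊓ 𝓟 H) (ball z₀ δ) := by
    rw [isOpen_ball.tendstoLocallyUniformlyOn_iff_forall_tendsto]
    intro w hw
    have hw' := hball (ball_subset_closedBall hw)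
    have h1 : Tendsto (fun y : C(OnePoint ℂ, M) × ℂ => F y.1 y.2) ((𝓝 γ ⊓ 𝓟 H) ×ˢ 𝓝 w)
        (𝓝 (F γ w)) := (hF w hw').mono_left (prod_mono_left _ inf_le_left)
    have h2 : Tendsto (fun y : C(OnePoint ℂ, M) × ℂ => F γ y.2) ((𝓝 γ ⊓ 𝓟 H) ×ˢ 𝓝 w)
        (𝓝 (F γ w)) :=
      ((hγd.differentiableAt (isOpen_ball.mem_nhds hw)).continuousAt.tendsto).comp tendsto_snd
    exact (h2.prodMk_nhds h1).mono_right (nhds_le_uniformity _)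
  have hder := (isOpen_ball.tendstoLocallyUniformlyOn_iff_forall_tendsto.1
    (hloc.deriv hdiff isOpen_ball)) z₀ (mem_ball_self hδ)
  have hcont : ContinuousAt (deriv (F γ)) z₀ :=
    ((hγd.analyticAt (isOpen_ball.mem_nhds (mem_ball_self hδ))).deriv).continuousAt
  have hder' : Tendsto (fun y : C(OnePoint ℂ, M) × ℂ => deriv (F y.1) y.2)
      ((𝓝 γ ⊓ 𝓟 H) ×ˢ 𝓝 z₀) (𝓝 (deriv (F γ) z₀)) :=
    (hcont.tendsto.comp tendsto_snd).congr_uniformity hder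
  have hform : Tendsto (fun y : C(OnePoint ℂ, M) × ℂ => localForm θ c (F y.1 y.2))
      ((𝓝 γ ⊓ 𝓟 H) ×ˢ 𝓝 z₀) (𝓝 (localForm θ c (F γ z₀))) :=
    ((hc.continuousAt (c.1.open_target.mem_nhds (c.1.map_source hz₀))).tendsto.comp
      (hF z₀ hz₀)).mono_left (prod_mono_left _ inf_le_left)
  have happ : Continuous fun a : (E →L[ℂ] ℂ) × E => a.1 a.2 :=
    continuous_fst.clm_apply continuous_snd
  have hlim := ((happ.tendsto _).comp (hform.prodMk_nhds hder')).eventually_ne hne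
  obtain ⟨P, hP, Q, hQ, hPQ⟩ := eventually_prod_iff.1 hlim
  rw [eventually_inf_principal] at hP
  have hin : ∀ᶠ y : C(OnePoint ℂ, M) × ℂ in 𝓝 (γ, z₀), ev y ∈ c.1.source :=
    (hev.tendsto (γ, z₀)).eventually (c.1.open_source.mem_nhds hz₀)
  rw [nhds_prod_eq] at hin ⊢
  filter_upwards [hP.prod_mk hQ, hin] with y hy hys hyH h0
  refine hPQ (hy.1 hyH) hy.2 ?_
  have hg : ContinuousAt (fun w => y.1 (e.coord w)) y.2 :=
    (y.1.continuous.comp e.isOpenEmbedding_coord.continuous).continuousAt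
  change localForm θ c (c.1 (y.1 (e.coord y.2))) (deriv (fun w => c.1 (y.1 (e.coord w))) y.2) = 0
  rw [localForm_velocity θ c hg hys (hyH.differentiableAt_chart e c hys)]
  rw [h0]
  exact map_zero _

/-- The other pole of the Riemann sphere. -/
def Pole.opposite : Pole → Pole
  | zero => infty
  | infty => zero

theorem Pole.opposite_coord_inv (e : Pole) {z : ℂ} (hz : z ≠ 0) :
    e.opposite.coord z⁻¹ = e.coord z := by
  cases e <;> simp [Pole.opposite, Pole.coord, hz]

/-- It suffices to test `NonzeroAlong` on the closed unit discs of the two coordinates, which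
together cover the Riemann sphere. -/
theorem nonzeroAlong_of_closedBall {N : AnticanonicalRoot E M} (θ : TwistedForm N)
    {f : OnePoint ℂ → M} (hf : IsHolomorphicCurve (E := E) f)
    (h : ∀ (e : Pole), ∀ z ∈ closedBall (0 : ℂ) 1, θ (f (e.coord z))
      (mfderiv 𝓘(ℂ, ℂ) 𝓘(ℂ, E) (fun w : ℂ => f (e.coord w)) z (1 : ℂ)) ≠ 0) :
    NonzeroAlong θ f := by
  intro e z
  by_cases hz : ‖z‖ ≤ 1
  · exact h e z (by simpa using hz)
  have hz0 : z ≠ 0 := by rintro rfl; simp at hz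
  have h1 := h e.opposite z⁻¹ (by
    simp only [mem_closedBall_zero_iff, norm_inv]
    exact inv_le_one_of_one_le₀ (not_le.1 hz).le)
  set g : ℂ → M := fun w => f (e.coord w) with hg
  set g' : ℂ → M := fun w => f (e.opposite.coord w) with hg'
  have hgg' : g' z⁻¹ = g z := congrArg f (e.opposite_coord_inv hz0)
  intro h0
  apply h1
  -- `g' w = g w⁻¹` near `z⁻¹`, so the two velocities are proportional.
  have hcomp : g' =ᶠ[𝓝 z⁻¹] fun w => g w⁻¹ := by
    filter_upwards [isOpen_ne.mem_nhds (inv_ne_zero hz0)] with w hw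
    have := e.opposite_coord_inv (inv_ne_zero hw)
    rw [inv_inv] at this
    exact congrArg f this
  set c := achart E (g z) with hc
  have hmem : g z ∈ c.1.source := mem_chart_source E (g z)
  have hd : DifferentiableAt ℂ (fun w => c.1 (g w)) z := hf.differentiableAt_chart e c hmem
  have hd' : DifferentiableAt ℂ (fun w => c.1 (g' w)) z⁻¹ :=
    hf.differentiableAt_chart e.opposite c (hgg'.symm ▸ hmem : g' z⁻¹ ∈ c.1.source)
  have hv : (mfderiv 𝓘(ℂ, ℂ) 𝓘(ℂ, E) g z (1 : ℂ) : E) = deriv (fun w => c.1 (g w)) z :=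
    mfderiv_eq_deriv_chart (hf e).continuous.continuousAt hd
  have hv' : (mfderiv 𝓘(ℂ, ℂ) 𝓘(ℂ, E) g' z⁻¹ (1 : ℂ) : E) = deriv (fun w => c.1 (g' w)) z⁻¹ := by
    have := mfderiv_eq_deriv_chart (E := E) (g := g') (z := z⁻¹)
      (hf e.opposite).continuous.continuousAt
    rw [hgg'] at this
    exact this hd'
  have key : deriv (fun w => c.1 (g' w)) z⁻¹ =
      deriv (fun w : ℂ => w⁻¹) z⁻¹ • deriv (fun w => c.1 (g w)) z := by
    have h2 : deriv (fun w => c.1 (g' w)) z⁻¹ = deriv (fun w => c.1 (g w⁻¹)) z⁻¹ :=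
      EventuallyEq.deriv_eq (hcomp.fun_comp c.1)
    have h3 := deriv.scomp (g₁ := fun w => c.1 (g w)) (h := fun w : ℂ => w⁻¹) z⁻¹
      (by simpa using hd) (differentiableAt_inv (inv_ne_zero hz0))
    rw [h2]
    simpa [Function.comp_def] using h3
  have hΘ : ∀ Θ : M → E →L[ℂ] ℂ, Θ (g z) (mfderiv 𝓘(ℂ, ℂ) 𝓘(ℂ, E) g z (1 : ℂ) : E) = 0 →
      Θ (g' z⁻¹) (mfderiv 𝓘(ℂ, ℂ) 𝓘(ℂ, E) g' z⁻¹ (1 : ℂ) : E) = 0 := by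
    intro Θ h2
    rw [hv', key, map_smul, hgg', ← hv, h2, smul_zero]
  exact hΘ (fun p => θ p) h0

/-- If at each point of the two closed unit discs `θ` is non-zero on the velocity of the holomorphic
curve `γ`, computed in some chart, then `θ` is non-zero along all holomorphic curves near `γ`. -/
theorem eventually_nonzeroAlong [CompleteSpace E] {N : AnticanonicalRoot E M} (θ : TwistedForm N)
    (γ : C(OnePoint ℂ, M)) (hγ : IsHolomorphicCurve (E := E) γ)
    (hc : ∀ c : atlas E M, ContinuousOn (localForm θ c) c.1.target)
    (h : ∀ (e : Pole), ∀ z ∈ closedBall (0 : ℂ) 1, ∃ c : atlas E M,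
      γ (e.coord z) ∈ c.1.source ∧
      localForm θ c (c.1 (γ (e.coord z))) (deriv (fun w => c.1 (γ (e.coord w))) z) ≠ 0) :
    ∀ᶠ f : C(OnePoint ℂ, M) in 𝓝 γ, IsHolomorphicCurve (E := E) f → NonzeroAlong θ f := by
  have key : ∀ e : Pole, ∀ᶠ f : C(OnePoint ℂ, M) in 𝓝 γ, ∀ z ∈ closedBall (0 : ℂ) 1,
      IsHolomorphicCurve (E := E) f → θ (f (e.coord z))
        (mfderiv 𝓘(ℂ, ℂ) 𝓘(ℂ, E) (fun w : ℂ => f (e.coord w)) z (1 : ℂ)) ≠ 0 := by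
    intro e
    refine (isCompact_closedBall (0 : ℂ) 1).eventually_forall_of_forall_eventually fun z hz => ?_
    obtain ⟨c, h1, h2⟩ := h e z hz
    exact eventually_velocity_ne_zero θ γ hγ e z c (hc c) h1 h2
  filter_upwards [key Pole.zero, key Pole.infty] with f h1 h2 hf
  refine nonzeroAlong_of_closedBall θ hf fun e z hz => ?_
  cases e with
  | zero => exact h1 z hz hf
  | infty => exact h2 z hz hf

end Curves

/-! ### The charts of the twistor space -/

namespace ToricData

variable (T : ToricData)

/-- The chart of a piece as an element of the atlas. -/
def chartOf (c : Piece) : atlas Model T.Z := ⟨T.pieceChart c, mem_range_self c⟩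

/-- The piece to which an element of the atlas belongs. -/
def pieceOf (e : atlas Model T.Z) : Piece := e.2.choose

theorem chartOf_pieceOf (e : atlas Model T.Z) : T.chartOf (T.pieceOf e) = e :=
  Subtype.ext e.2.choose_spec

/-- All representatives of a point of a piece lie in the domain of the coordinates of that piece. -/
theorem exists_coord_of_mem_source {c : Piece} {x : T.Pre}
    (h : T.proj x ∈ (T.pieceChart c).source) :
    ∃ z, (z, x.1.2) ∈ T.domain c ∧ x.1.1 = c.coord z := by
  have hr := T.r_lt_one
  obtain ⟨y, hy⟩ := h
  rcases T.proj_eq_iff.1 hy.symm with rfl | ⟨e, z, hz, h1, h2, h3⟩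
  · exact ⟨y.1.1, y.2, rfl⟩
  · cases c with
    | annulus =>
      exfalso
      have hz2 := T.norm_lt_of_coord h2 y.2.1
      rw [norm_neg] at hz2
      exact T.separated e z hz2 hz x.1.2 x.2 (h3 ▸ y.2.2)
    | disc e' =>
      obtain ⟨rfl, -⟩ := eq_or_eq_neg_of_pole (y.2.1.trans hr)
        (by simpa using hz.trans hr : ‖-z‖ < 1) h2
      exact ⟨z, ⟨hz, x.2⟩, h1⟩

theorem pieceChart_symm_localCoord {c : Piece} {x : Model} (hx : x ∈ T.domain c) :
    (T.pieceChart c).symm (T.localCoord c x) = T.proj (T.pieceMap c ⟨x, hx⟩) := by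
  rw [← T.pieceChart_apply c ⟨x, hx⟩]
  exact (T.pieceChart c).left_inv ⟨_, rfl⟩

theorem localCoord_mem_target {c : Piece} {x : Model} (hx : x ∈ T.domain c) :
    T.localCoord c x ∈ (T.pieceChart c).target := by
  rw [← T.pieceChart_apply c ⟨x, hx⟩]
  exact (T.pieceChart c).map_source ⟨_, rfl⟩

/-- The point over the pole `e` lies in the disc piece of `e` only, so the charts of the three
pieces are different. -/
theorem pieceChart_injective : Function.Injective T.pieceChart := by
  have hr := T.r_lt_one
  have h0 := T.r_pos
  have key : ∀ (e : Pole) (c : Piece),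
      (T.pieceChart (Piece.disc e)).source = (T.pieceChart c).source → c = Piece.disc e := by
    intro e c h
    have h1 : T.proj ⟨(e.coord 0, 0), T.zero_mem_U⟩ ∈ (T.pieceChart (Piece.disc e)).source :=
      ⟨⟨(0, 0), ⟨by simpa using h0, T.zero_mem_U⟩⟩, rfl⟩
    rw [h] at h1
    obtain ⟨z, hz, hzc⟩ := T.exists_coord_of_mem_source h1
    cases c with
    | annulus =>
      have := T.norm_lt_of_coord hzc.symm hz.1
      simp only [norm_zero] at this
      linarith
    | disc e' =>
      rw [(eq_or_eq_neg_of_pole (by simp) (hz.1.trans hr) hzc).1]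
  intro c c' h
  cases c with
  | disc e => exact (key e c' (by rw [h])).symm
  | annulus =>
    cases c' with
    | annulus => rfl
    | disc e => exact key e _ (by rw [h])

theorem pieceOf_chartOf (c : Piece) : T.pieceOf (T.chartOf c) = c :=
  T.pieceChart_injective (congrArg Subtype.val (T.chartOf_pieceOf (T.chartOf c)))

theorem exists_eq_chartOf (e : atlas Model T.Z) : ∃ c, e = T.chartOf c :=
  ⟨T.pieceOf e, (T.chartOf_pieceOf e).symm⟩

theorem pieceChart_mem_domain {p : T.Z} (hp : p ∈ (T.pieceChart Piece.annulus).source) :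
    T.pieceChart Piece.annulus p ∈ T.domain Piece.annulus := by
  obtain ⟨y, rfl⟩ := hp
  have := T.pieceChart_apply Piece.annulus y
  exact (show T.pieceChart Piece.annulus (T.proj (T.pieceMap Piece.annulus y)) = y.1 from this) ▸ y.2

/-- The change of coordinates from the annulus piece to a disc piece. -/
theorem overlap {e : Pole} {p : T.Z} (hp : p ∈ (T.pieceChart Piece.annulus).source)
    (hp' : p ∈ (T.pieceChart (Piece.disc e)).source) :
    ‖poleCoord e (T.pieceChart Piece.annulus p).1‖ < T.r ∧
      T.pieceChart (Piece.disc e) p = T.localCoord (Piece.disc e)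
        (poleCoord e (T.pieceChart Piece.annulus p).1, (T.pieceChart Piece.annulus p).2) := by
  have h := T.mem_overlap (e := e) (T.pieceChart_mem_domain hp)
    (by rwa [(T.pieceChart Piece.annulus).left_inv hp])
  rwa [(T.pieceChart Piece.annulus).left_inv hp] at h

theorem ne_zero_of_mem_source {p : T.Z} (hp : p ∈ (T.pieceChart Piece.annulus).source) :
    (T.pieceChart Piece.annulus p).1 ≠ 0 :=
  T.ne_zero_of_mem_annulus (T.pieceChart_mem_domain hp)

theorem contMDiffOn_pieceChart (c : Piece) :
    ContMDiffOn 𝓘(ℂ, Model) 𝓘(ℂ, Model) ω (T.pieceChart c) (T.pieceChart c).source :=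
  contMDiffOn_of_mem_maximalAtlas (IsManifold.subset_maximalAtlas (T.chartOf c).2)

end ToricData

/-- The derivative of `(z, v) ↦ (g z, v + h z)` when `g' = a` and `h' = b`. -/
def shearMap (a : ℂ) (b : Fin 2 → ℂ) : Model →L[ℂ] Model :=
  ((ContinuousLinearMap.fst ℂ ℂ (Fin 2 → ℂ)).smulRight a).prod
    (ContinuousLinearMap.snd ℂ ℂ (Fin 2 → ℂ) +
      (ContinuousLinearMap.fst ℂ ℂ (Fin 2 → ℂ)).smulRight b)

theorem shearMap_apply (a : ℂ) (b : Fin 2 → ℂ) (y : Model) :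
    shearMap a b y = (y.1 * a, y.2 + y.1 • b) := rfl

theorem hasFDerivAt_shearMap {g : ℂ → ℂ} {h : ℂ → Fin 2 → ℂ} {x : Model} {a : ℂ}
    {b : Fin 2 → ℂ} (hg : HasDerivAt g a x.1) (hh : HasDerivAt h b x.1) :
    HasFDerivAt (fun y : Model => (g y.1, y.2 + h y.1)) (shearMap a b) x := by
  have h1 := hg.hasFDerivAt.comp x (hasFDerivAt_fst (𝕜 := ℂ) (p := x))
  have h2 := hh.hasFDerivAt.comp x (hasFDerivAt_fst (𝕜 := ℂ) (p := x))
  refine (h1.prodMk ((hasFDerivAt_snd (𝕜 := ℂ) (p := x)).add h2)).congr_fderiv ?_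
  refine ContinuousLinearMap.ext fun y => ?_
  simp [shearMap_apply]

theorem det_shearMap (a : ℂ) (b : Fin 2 → ℂ) : (shearMap a b).det = a := by
  let B := (Module.Basis.singleton Unit ℂ).prod (Pi.basisFun ℂ (Fin 2))
  have h : LinearMap.toMatrix B B (shearMap a b).toLinearMap =
      Matrix.fromBlocks (Matrix.of fun _ _ => a) 0 (Matrix.of fun j _ => b j) 1 := by
    ext i j
    rcases i with i | i <;> rcases j with j | j <;>
      simp [LinearMap.toMatrix_apply, B, shearMap_apply, Matrix.one_apply, Pi.single_apply]
  rw [ContinuousLinearMap.det, ← LinearMap.det_toMatrix B, h, Matrix.det_fromBlocks_zero₁₂]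
  simp

/-! ### The square root of the anticanonical bundle -/

namespace ToricData

/-- The factor relating the frame of `K^{-1/2}` over the annulus piece to that over the disc piece
of a pole, in terms of the first coordinate `s = ζ²` of the latter. -/
def weight : Pole → ℂ → ℂ
  | Pole.zero => fun _ => 1
  | Pole.infty => fun s => s

/-- The sign with which `dζ / dz` is `weight e (ζ ^ 2)`: `1` at `0`, where `ζ = z`, and `-1` at `∞`,
where `ζ = 1 / z` and `dζ / dz = -ζ²`. -/
def poleSign : Pole → ℂ
  | Pole.zero => 1
  | Pole.infty => -1

theorem poleSign_ne_zero (e : Pole) : poleSign e ≠ 0 := by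
  cases e <;> simp [poleSign]

theorem poleSign_mul_self (e : Pole) : poleSign e * poleSign e = 1 := by
  cases e <;> simp [poleSign]

theorem contDiff_weight (e : Pole) : ContDiff ℂ ω (weight e) := by
  cases e with
  | zero => exact contDiff_const
  | infty => exact contDiff_id

theorem weight_ne_zero (e : Pole) {z : ℂ} (hz : z ≠ 0) : weight e (poleCoord e z ^ 2) ≠ 0 := by
  cases e <;> simp [weight, poleCoord, hz]

/-- In other words `weight e (ζ ^ 2) = ζ / z`. -/
theorem weight_mul (e : Pole) {z : ℂ} (hz : z ≠ 0) :
    weight e (poleCoord e z ^ 2) * z = poleCoord e z := by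
  cases e
  · simp [weight, poleCoord]
  · simp [weight, poleCoord]; field_simp

theorem deriv_poleCoord (e : Pole) (z : ℂ) :
    deriv (poleCoord e) z = poleSign e * weight e (poleCoord e z ^ 2) := by
  cases e with
  | zero => simp [poleSign, weight, poleCoord]
  | infty => simp [poleSign, weight, poleCoord]

/-- The isomorphism of the square of `K^{-1/2}` with `K⁻¹` over a piece, as a function of the first
coordinate: the square of the frame over the annulus piece is `(2 z)⁻¹ ∂_z ∧ ∂₁ ∧ ∂₂`, which
extends over the disc piece of `0` as `∂_s ∧ ∂₁ ∧ ∂₂` because `s = z²`. -/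
def rootUnit : Piece → ℂ → ℂ
  | Piece.annulus => fun z => (2 * z)⁻¹
  | Piece.disc e => fun _ => poleSign e

variable (T : ToricData)

/-- The transition functions of `K^{-1/2}` between the pieces. The two disc pieces are disjoint. -/
def lineTransition : Piece → Piece → T.Z → ℂ
  | Piece.annulus, Piece.disc e => fun p => weight e (T.pieceChart (Piece.disc e) p).1
  | Piece.disc e, Piece.annulus => fun p => (weight e (T.pieceChart (Piece.disc e) p).1)⁻¹
  | Piece.annulus, Piece.annulus => fun _ => 1
  | Piece.disc _, Piece.disc _ => fun _ => 1

theorem weight_overlap_ne_zero {e : Pole} {p : T.Z}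
    (hp : p ∈ (T.pieceChart Piece.annulus).source)
    (hp' : p ∈ (T.pieceChart (Piece.disc e)).source) :
    weight e (T.pieceChart (Piece.disc e) p).1 ≠ 0 := by
  rw [(T.overlap hp hp').2]
  exact weight_ne_zero e (T.ne_zero_of_mem_source hp)

theorem eq_of_mem_disc_source {e e' : Pole} {p : T.Z}
    (hp : p ∈ (T.pieceChart (Piece.disc e)).source)
    (hp' : p ∈ (T.pieceChart (Piece.disc e')).source) : e = e' := by
  by_contra h
  exact T.disjoint_disc_source h hp hp'

theorem lineTransition_self (c : Piece) (p : T.Z) : T.lineTransition c c p = 1 := by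
  cases c <;> rfl

theorem lineTransition_comp (c c' c'' : Piece) {p : T.Z} (h : p ∈ (T.pieceChart c).source)
    (h' : p ∈ (T.pieceChart c').source) (h'' : p ∈ (T.pieceChart c'').source) :
    T.lineTransition c' c'' p * T.lineTransition c c' p = T.lineTransition c c'' p := by
  rcases c with e | _ <;> rcases c' with e' | _ <;> rcases c'' with e'' | _ <;>
    simp only [lineTransition, mul_one, one_mul]
  · rw [T.eq_of_mem_disc_source h h']
  · rw [T.eq_of_mem_disc_source h h'', mul_inv_cancel₀ (T.weight_overlap_ne_zero h' h'')]
  · rw [T.eq_of_mem_disc_source h' h'']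
  · rw [inv_mul_cancel₀ (T.weight_overlap_ne_zero h h')]

theorem contMDiffOn_lineTransition (c c' : Piece) :
    ContMDiffOn 𝓘(ℂ, Model) 𝓘(ℂ, ℂ) ω (T.lineTransition c c')
      ((T.pieceChart c).source ∩ (T.pieceChart c').source) := by
  have hw : ∀ e, ContMDiffOn 𝓘(ℂ, Model) 𝓘(ℂ, ℂ) ω
      (fun p => weight e (T.pieceChart (Piece.disc e) p).1)
      (T.pieceChart (Piece.disc e)).source := by
    intro e
    have h1 : ContMDiff 𝓘(ℂ, Model) 𝓘(ℂ, ℂ) ω (fun x : Model => weight e x.1) :=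
      ((contDiff_weight e).comp contDiff_fst).contMDiff
    exact h1.comp_contMDiffOn (T.contMDiffOn_pieceChart _)
  rcases c with e | _ <;> rcases c' with e' | _ <;> simp only [lineTransition]
  · exact contMDiffOn_const
  · intro p hp
    have h1 : ContMDiffAt 𝓘(ℂ, ℂ) 𝓘(ℂ, ℂ) ω (fun z : ℂ => z⁻¹)
        (weight e (T.pieceChart (Piece.disc e) p).1) :=
      (contDiffAt_inv ℂ (T.weight_overlap_ne_zero hp.2 hp.1)).contMDiffAt
    exact h1.comp_contMDiffWithinAt p ((hw e p hp.1).mono inter_subset_left)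
  · exact (hw e').mono inter_subset_right
  · exact contMDiffOn_const

theorem tangentCoordChange_annulus_disc {e : Pole} {p : T.Z}
    (hp : p ∈ (T.pieceChart Piece.annulus).source)
    (hp' : p ∈ (T.pieceChart (Piece.disc e)).source) :
    (tangentBundleCore 𝓘(ℂ, Model) T.Z).coordChange (T.chartOf Piece.annulus)
        (T.chartOf (Piece.disc e)) p =
      shearMap (2 * poleCoord e (T.pieceChart Piece.annulus p).1 *
          deriv (poleCoord e) (T.pieceChart Piece.annulus p).1)
        ((1 / 2 : ℂ) • (deriv (poleCoord e) (T.pieceChart Piece.annulus p).1 •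
          deriv (poleMap T.φ e) (poleCoord e (T.pieceChart Piece.annulus p).1))) := by
  rw [tangentCoordChange_eq_fderiv]
  have hx : T.pieceChart Piece.annulus p ∈
      ((T.pieceChart Piece.annulus).symm ≫ₕ T.pieceChart (Piece.disc e)).source := by
    rw [OpenPartialHomeomorph.trans_source]
    refine ⟨(T.pieceChart Piece.annulus).map_source hp, ?_⟩
    simpa [(T.pieceChart Piece.annulus).left_inv hp] using hp'
  have h0 := T.ne_zero_of_mem_source hp
  have hr := (T.overlap hp hp').1
  have h1 := (analyticAt_poleCoord e h0).differentiableAt.hasDerivAt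
  have h2 := ((T.analyticAt_poleMap e hr).differentiableAt.hasDerivAt.scomp _ h1).const_smul
    (1 / 2 : ℂ)
  have h3 : HasDerivAt (fun z => poleCoord e z ^ 2) (2 * poleCoord e (T.pieceChart Piece.annulus p).1
      * deriv (poleCoord e) (T.pieceChart Piece.annulus p).1) (T.pieceChart Piece.annulus p).1 := by
    simpa using h1.fun_pow 2
  exact ((hasFDerivAt_shearMap h3 h2).congr_of_eventuallyEq (T.transition_eventuallyEq hx)).fderiv

theorem tangentCoordChange_self {e : atlas Model T.Z} {p : T.Z} (hp : p ∈ e.1.source) :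
    (tangentBundleCore 𝓘(ℂ, Model) T.Z).coordChange e e p = ContinuousLinearMap.id ℂ Model :=
  ContinuousLinearMap.ext fun v => (tangentBundleCore 𝓘(ℂ, Model) T.Z).coordChange_self e p hp v

theorem tangentCoordChange_comp {e e' : atlas Model T.Z} {p : T.Z} (hp : p ∈ e.1.source)
    (hp' : p ∈ e'.1.source) :
    ((tangentBundleCore 𝓘(ℂ, Model) T.Z).coordChange e' e p).comp
      ((tangentBundleCore 𝓘(ℂ, Model) T.Z).coordChange e e' p) =
        ContinuousLinearMap.id ℂ Model := by
  refine ContinuousLinearMap.ext fun v => ?_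
  exact ((tangentBundleCore 𝓘(ℂ, Model) T.Z).coordChange_comp e e' e p ⟨⟨hp, hp'⟩, hp⟩ v).trans
    ((tangentBundleCore 𝓘(ℂ, Model) T.Z).coordChange_self e p hp v)

/-- The squares of the transition functions of `K^{-1/2}` are those of `K⁻¹` in the frames
`rootUnit`. From the annulus to a disc the Jacobian is that of `s = ζ²`, namely `2 ζ dζ / dz`. -/
theorem lineTransition_sq (c c' : Piece) {p : T.Z} (hp : p ∈ (T.pieceChart c).source)
    (hp' : p ∈ (T.pieceChart c').source) :
    T.lineTransition c c' p ^ 2 * rootUnit c' (T.pieceChart c' p).1 =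
      ((tangentBundleCore 𝓘(ℂ, Model) T.Z).coordChange (T.chartOf c) (T.chartOf c') p).det *
        rootUnit c (T.pieceChart c p).1 := by
  have hself : ∀ c, p ∈ (T.pieceChart c).source → ((tangentBundleCore 𝓘(ℂ, Model) T.Z).coordChange
      (T.chartOf c) (T.chartOf c) p).det = 1 := by
    intro c hc
    rw [T.tangentCoordChange_self hc]
    exact LinearMap.det_id
  have hforward : ∀ e, p ∈ (T.pieceChart Piece.annulus).source →
      p ∈ (T.pieceChart (Piece.disc e)).source →
      weight e (T.pieceChart (Piece.disc e) p).1 ^ 2 * poleSign e =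
        ((tangentBundleCore 𝓘(ℂ, Model) T.Z).coordChange (T.chartOf Piece.annulus)
          (T.chartOf (Piece.disc e)) p).det * (2 * (T.pieceChart Piece.annulus p).1)⁻¹ := by
    intro e h h'
    rw [T.tangentCoordChange_annulus_disc h h', det_shearMap, deriv_poleCoord, (T.overlap h h').2]
    have h0 := T.ne_zero_of_mem_source h
    have h1 := weight_mul e h0
    simp only [localCoord]
    rw [eq_mul_inv_iff_mul_eq₀ (by simpa using h0)]
    linear_combination
      (2 * poleSign e * weight e (poleCoord e (T.pieceChart Piece.annulus p).1 ^ 2)) * h1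
  rcases c with e | _ <;> rcases c' with e' | _
  · obtain rfl := T.eq_of_mem_disc_source hp hp'
    rw [hself _ hp, lineTransition_self]
    simp
  · have h1 := hforward e hp' hp
    have h2 := congrArg ContinuousLinearMap.det (T.tangentCoordChange_comp
      (e := T.chartOf Piece.annulus) (e' := T.chartOf (Piece.disc e)) hp' hp)
    have h3 : ∀ A B : Model →L[ℂ] Model, (A.comp B).det = A.det * B.det := fun A B =>
      LinearMap.det_comp _ _
    have h4 : (ContinuousLinearMap.id ℂ Model).det = 1 := LinearMap.det_id
    rw [h3, h4] at h2
    have h5 := T.weight_overlap_ne_zero hp' hp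
    simp only [lineTransition, rootUnit]
    rw [inv_pow, inv_mul_eq_iff_eq_mul₀ (pow_ne_zero 2 h5)]
    linear_combination
      -(2 * (T.pieceChart Piece.annulus p).1)⁻¹ * h2 -
      ((tangentBundleCore 𝓘(ℂ, Model) T.Z).coordChange (T.chartOf (Piece.disc e))
        (T.chartOf Piece.annulus) p).det * h1
  · exact hforward e' hp hp'
  · rw [hself _ hp, lineTransition_self]
    simp

/-- The line bundle `K^{-1/2}` over the twistor space. -/
def lineCore : VectorBundleCore ℂ T.Z ℂ (atlas Model T.Z) where
  baseSet e := e.1.source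
  isOpen_baseSet e := e.1.open_source
  indexAt := achart Model
  mem_baseSet_at := mem_chart_source Model
  coordChange e e' p := T.lineTransition (T.pieceOf e) (T.pieceOf e') p • ContinuousLinearMap.id ℂ ℂ
  coordChange_self e p _ v := by simp [lineTransition_self]
  continuousOn_coordChange e e' := by
    obtain ⟨c, rfl⟩ := T.exists_eq_chartOf e
    obtain ⟨c', rfl⟩ := T.exists_eq_chartOf e'
    simp only [pieceOf_chartOf]
    exact (T.contMDiffOn_lineTransition c c').continuousOn.smul continuousOn_const
  coordChange_comp e e' e'' p hp v := by
    obtain ⟨c, rfl⟩ := T.exists_eq_chartOf e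
    obtain ⟨c', rfl⟩ := T.exists_eq_chartOf e'
    obtain ⟨c'', rfl⟩ := T.exists_eq_chartOf e''
    simp [pieceOf_chartOf, ← T.lineTransition_comp c c' c'' hp.1.1 hp.1.2 hp.2, mul_assoc]

/-- The bundle `K^{-1/2}` as a square root of the anticanonical bundle. -/
def root : AnticanonicalRoot Model T.Z where
  core := T.lineCore
  baseSet_eq _ := rfl
  isContMDiff := by
    refine ⟨fun e e' => ?_⟩
    obtain ⟨c, rfl⟩ := T.exists_eq_chartOf e
    obtain ⟨c', rfl⟩ := T.exists_eq_chartOf e'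
    simp only [lineCore, pieceOf_chartOf]
    exact (T.contMDiffOn_lineTransition c c').smul contMDiffOn_const
  unit e p := rootUnit (T.pieceOf e) (e.1 p).1
  unit_ne_zero e p hp := by
    obtain ⟨c, rfl⟩ := T.exists_eq_chartOf e
    rw [pieceOf_chartOf]
    cases c with
    | annulus => exact inv_ne_zero (mul_ne_zero two_ne_zero (T.ne_zero_of_mem_source hp))
    | disc e => exact poleSign_ne_zero e
  contMDiffOn_unit e := by
    obtain ⟨c, rfl⟩ := T.exists_eq_chartOf e
    rw [pieceOf_chartOf]
    cases c with
    | disc e => exact contMDiffOn_const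
    | annulus =>
      intro p hp
      have h0 : (2 : ℂ) * (T.pieceChart Piece.annulus p).1 ≠ 0 := by
        simpa using T.ne_zero_of_mem_source hp
      have h1 : ContDiffAt ℂ ω (fun x : Model => (2 * x.1)⁻¹) (T.pieceChart Piece.annulus p) :=
        (contDiffAt_const.mul contDiffAt_fst).inv h0
      exact h1.contMDiffAt.comp_contMDiffWithinAt p (T.contMDiffOn_pieceChart _ p hp)
  sq_coordChange e e' p hp := by
    obtain ⟨c, rfl⟩ := T.exists_eq_chartOf e
    obtain ⟨c', rfl⟩ := T.exists_eq_chartOf e'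
    simp only [lineCore, pieceOf_chartOf]
    rw [smul_apply, ContinuousLinearMap.id_apply, smul_eq_mul, mul_one]
    exact T.lineTransition_sq c c' hp.1 hp.2

theorem root_coordChange (c c' : Piece) (p : T.Z) :
    T.root.core.coordChange (T.chartOf c) (T.chartOf c') p =
      T.lineTransition c c' p • ContinuousLinearMap.id ℂ ℂ := by
  simp [root, lineCore, pieceOf_chartOf]

end ToricData

/-! ### The contact form -/

/-- The one-form `∑ c_j dv_j` with constant coefficients. -/
def pairing : (Fin 2 → ℂ) →L[ℂ] Model →L[ℂ] ℂ :=
  ∑ j, (ContinuousLinearMap.proj j : (Fin 2 → ℂ) →L[ℂ] ℂ).smulRight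
    ((ContinuousLinearMap.proj j : (Fin 2 → ℂ) →L[ℂ] ℂ).comp
      (ContinuousLinearMap.snd ℂ ℂ (Fin 2 → ℂ)))

theorem pairing_apply (c : Fin 2 → ℂ) (y : Model) : pairing c y = ∑ j, c j * y.2 j := by
  simp [pairing]

/-- For the quadratic polynomials `a_j z² + b_j`, the coefficients of `ζ²` in the coordinate `ζ` of
a pole. -/
def leadCoeff (a b : Fin 2 → ℂ) : Pole → Fin 2 → ℂ
  | Pole.zero => a
  | Pole.infty => b

/-- For the quadratic polynomials `a_j z² + b_j`, the constant coefficients in the coordinate `ζ` of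
a pole. -/
def constCoeff (a b : Fin 2 → ℂ) : Pole → Fin 2 → ℂ
  | Pole.zero => b
  | Pole.infty => a

/-- The local expressions of the contact form: `dz + ∑ q_j dv_j` with `q_j = a_j z² + b_j` over the
annulus piece. In the coordinates `(s, w) = (z², v + φ z / 2)` of a disc piece the
first term is absorbed by `∑ q_j φ_j' = 2`, and `∑ (a_j s + b_j) dw_j` remains. -/
def contactForm (a b : Fin 2 → ℂ) : Piece → Model → Model →L[ℂ] ℂ
  | Piece.annulus => fun x =>
      ContinuousLinearMap.fst ℂ ℂ (Fin 2 → ℂ) + pairing (x.1 ^ 2 • a + b)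
  | Piece.disc e => fun x => pairing (x.1 • leadCoeff a b e + constCoeff a b e)

theorem contDiff_contactForm (a b : Fin 2 → ℂ) (c : Piece) : ContDiff ℂ ω (contactForm a b c) := by
  cases c with
  | annulus =>
    exact contDiff_const.add
      (pairing.contDiff.comp (((contDiff_fst.pow 2).smul contDiff_const).add contDiff_const))
  | disc e =>
    exact pairing.contDiff.comp ((contDiff_fst.smul contDiff_const).add contDiff_const)

theorem contactForm_eq_of_fst_eq (a b : Fin 2 → ℂ) (c : Piece) {x y : Model} (h : x.1 = y.1) :
    contactForm a b c x = contactForm a b c y := by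
  cases c <;> simp only [contactForm, h]

theorem fderiv_contactForm_annulus (a b : Fin 2 → ℂ) (x X : Model) :
    fderiv ℂ (contactForm a b Piece.annulus) x X = pairing ((2 * x.1 * X.1) • a) := by
  have h1 : HasFDerivAt (fun y : Model => y.1 ^ 2 • a + b) _ x :=
    ((((hasFDerivAt_fst (𝕜 := ℂ) (p := x))).pow 2).smul_const a).add_const b
  have h2 : HasFDerivAt (contactForm a b Piece.annulus) _ x :=
    ((pairing.hasFDerivAt (x := x.1 ^ 2 • a + b)).comp x h1).const_add
      (ContinuousLinearMap.fst ℂ ℂ (Fin 2 → ℂ))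
  rw [h2.fderiv]
  simp [mul_assoc]

theorem fderiv_contactForm_disc (a b : Fin 2 → ℂ) (e : Pole) (x X : Model) :
    fderiv ℂ (contactForm a b (Piece.disc e)) x X = pairing (X.1 • leadCoeff a b e) := by
  have h1 : HasFDerivAt (fun y : Model => y.1 • leadCoeff a b e + constCoeff a b e) _ x :=
    ((hasFDerivAt_fst (𝕜 := ℂ) (p := x)).smul_const (leadCoeff a b e)).add_const _
  have h2 : HasFDerivAt (contactForm a b (Piece.disc e)) _ x :=
    (pairing.hasFDerivAt (x := x.1 • leadCoeff a b e + constCoeff a b e)).comp x h1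
  rw [h2.fderiv]
  simp

theorem leadCoeff_det_ne_zero {a b : Fin 2 → ℂ} (hab : a 0 * b 1 - a 1 * b 0 ≠ 0) (e : Pole) :
    leadCoeff a b e 0 * constCoeff a b e 1 - leadCoeff a b e 1 * constCoeff a b e 0 ≠ 0 := by
  cases e with
  | zero => exact hab
  | infty =>
    intro h
    simp only [leadCoeff, constCoeff] at h
    exact hab (by linear_combination -h)

/-- The contact condition for `∑ (A_j s + B_j) dw_j`: its differential `ds ∧ ∑ A_j dw_j` is
non-degenerate on the kernel because `A` and `s A + B` are independent. -/
theorem contactForm_disc_nondegenerate {a b : Fin 2 → ℂ} (hab : a 0 * b 1 - a 1 * b 0 ≠ 0)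
    (e : Pole) (x : Model) :
    contactForm a b (Piece.disc e) x ≠ 0 ∧
      ∀ X : Model, contactForm a b (Piece.disc e) x X = 0 → X ≠ 0 →
        ∃ Y : Model, contactForm a b (Piece.disc e) x Y = 0 ∧
          fderiv ℂ (contactForm a b (Piece.disc e)) x X Y -
            fderiv ℂ (contactForm a b (Piece.disc e)) x Y X ≠ 0 := by
  simp only [fderiv_contactForm_disc]
  have hd := leadCoeff_det_ne_zero hab e
  obtain ⟨s, v⟩ := x
  simp only [contactForm]
  generalize leadCoeff a b e = A at *
  generalize constCoeff a b e = B at *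
  simp only [pairing_apply, Fin.sum_univ_two, Pi.add_apply, Pi.smul_apply, smul_eq_mul]
  refine ⟨fun h => hd ?_, ?_⟩
  · have h0 := congrArg (fun l : Model →L[ℂ] ℂ => l (0, ![1, 0])) h
    have h1 := congrArg (fun l : Model →L[ℂ] ℂ => l (0, ![0, 1])) h
    simp [pairing_apply, Fin.sum_univ_two] at h0 h1
    linear_combination A 0 * h1 - A 1 * h0
  · rintro ⟨ξ, u⟩ hX hX0
    by_cases hξ : ξ = 0
    · subst hξ
      refine ⟨(1, 0), by simp, ?_⟩
      simp only [zero_mul, zero_sub, one_mul, add_zero]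
      intro h
      -- `A` and `s A + B` are independent, so `u` vanishes.
      have e1 : A 0 * u 0 + A 1 * u 1 = 0 := by linear_combination -h
      have e2 : (s * A 0 + B 0) * u 0 + (s * A 1 + B 1) * u 1 = 0 := hX
      have u0 : u 0 = 0 := by
        refine (mul_eq_zero.1 (?_ : (A 0 * B 1 - A 1 * B 0) * u 0 = 0)).resolve_left hd
        linear_combination (s * A 1 + B 1) * e1 - A 1 * e2
      have u1 : u 1 = 0 := by
        refine (mul_eq_zero.1 (?_ : (A 0 * B 1 - A 1 * B 0) * u 1 = 0)).resolve_left hd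
        linear_combination A 0 * e2 - (s * A 0 + B 0) * e1
      apply hX0
      refine Prod.ext rfl ?_
      funext j
      fin_cases j
      · exact u0
      · exact u1
    · -- Take `w` in the kernel of `s A + B`, on which `A` does not vanish.
      refine ⟨(0, ![-(s * A 1 + B 1), s * A 0 + B 0]), ?_, ?_⟩
      · simp; ring
      · simp only [Matrix.cons_val_zero, Matrix.cons_val_one, zero_mul, add_zero, sub_zero]
        intro h
        refine mul_ne_zero hξ hd ?_
        linear_combination -h

/-- The contact condition for `dz + ∑ (a_j z² + b_j) dv_j` at `z ≠ 0`. -/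
theorem contactForm_annulus_nondegenerate {a b : Fin 2 → ℂ} (hab : a 0 * b 1 - a 1 * b 0 ≠ 0)
    (x : Model) (hx : x.1 ≠ 0) :
    contactForm a b Piece.annulus x ≠ 0 ∧
      ∀ X : Model, contactForm a b Piece.annulus x X = 0 → X ≠ 0 →
        ∃ Y : Model, contactForm a b Piece.annulus x Y = 0 ∧
          fderiv ℂ (contactForm a b Piece.annulus) x X Y -
            fderiv ℂ (contactForm a b Piece.annulus) x Y X ≠ 0 := by
  simp only [fderiv_contactForm_annulus]
  obtain ⟨z, v⟩ := x
  simp only [contactForm, add_apply, ContinuousLinearMap.coe_fst',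
    pairing_apply, Fin.sum_univ_two, Pi.add_apply, Pi.smul_apply, smul_eq_mul] at hx ⊢
  refine ⟨fun h => ?_, ?_⟩
  · have h0 := congrArg (fun l : Model →L[ℂ] ℂ => l (1, 0)) h
    simp [pairing_apply] at h0
  · rintro ⟨ξ, u⟩ hX hX0
    simp only at hX
    have hne : u 0 ≠ 0 ∨ u 1 ≠ 0 := by
      by_contra! h
      apply hX0
      rw [h.1, h.2] at hX
      refine Prod.ext (by simpa using hX) ?_
      funext j
      fin_cases j
      · exact h.1
      · exact h.2
    -- On the kernel, with coordinates `v`, the two-form is `2 z (a₀ b₁ - a₁ b₀)` times the area form.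
    have key : ∀ w : Fin 2 → ℂ, u 0 * w 1 - u 1 * w 0 ≠ 0 → ∃ Y : Model,
        Y.1 + ((z ^ 2 * a 0 + b 0) * Y.2 0 + (z ^ 2 * a 1 + b 1) * Y.2 1) = 0 ∧
        2 * z * ξ * a 0 * Y.2 0 + 2 * z * ξ * a 1 * Y.2 1 -
          (2 * z * Y.1 * a 0 * u 0 + 2 * z * Y.1 * a 1 * u 1) ≠ 0 := by
      intro w hw
      refine ⟨(-((z ^ 2 * a 0 + b 0) * w 0 + (z ^ 2 * a 1 + b 1) * w 1), w), by ring, ?_⟩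
      intro h
      refine mul_ne_zero (mul_ne_zero (mul_ne_zero two_ne_zero hx) hab) hw ?_
      simp only at h
      linear_combination h - 2 * z * (a 0 * w 0 + a 1 * w 1) * hX
    rcases hne with h | h
    · exact key ![0, 1] (by simpa using h)
    · exact key ![1, 0] (by simpa using h)

namespace ToricData

variable (T : ToricData)

/-- The condition `∑ q_j φ_j' = 2`, for `q_j = a_j z² + b_j`, written in the coordinate of each of
the two poles: near `∞` multiplication by `ζ²` and `dφ / dz = -ζ² dφ / dζ` turn the right-hand side
into `-2`. The poles themselves are included. -/
def Normalized (a b : Fin 2 → ℂ) : Prop :=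
  ∀ (e : Pole) (z : ℂ), ‖z‖ < T.r →
    ∑ j, (z ^ 2 * leadCoeff a b e j + constCoeff a b e j) * deriv (poleMap T.φ e) z j =
      2 * poleSign e

theorem normalized_of_sum_mul_deriv_eq {a b : Fin 2 → ℂ}
    (h0 : ∀ z : ℂ, ‖z‖ < T.r → ∑ j, (a j * z ^ 2 + b j) * deriv (fun w => T.φ w j) z = 2)
    (h1 : ∀ z : ℂ, T.r⁻¹ < ‖z‖ →
      ∑ j, (a j * z ^ 2 + b j) * deriv (fun w => reflected T.φ w j) z = 2) :
    T.Normalized a b := by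
  intro e z hz
  have hpi : ∀ (e : Pole) {z : ℂ}, ‖z‖ < T.r → ∀ j, deriv (poleMap T.φ e) z j =
      deriv (fun w => poleMap T.φ e w j) z := fun e z hz j =>
    ((hasDerivAt_pi.1 (T.analyticAt_poleMap e hz).differentiableAt.hasDerivAt) j).deriv.symm
  cases e with
  | zero =>
    simp only [hpi Pole.zero hz, leadCoeff, constCoeff, poleSign, mul_one]
    rw [← h0 z hz]
    exact Finset.sum_congr rfl fun j _ => by rw [mul_comm (z ^ 2)]; rfl
  | infty =>
    simp only [leadCoeff, constCoeff, poleSign]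
    have hpunct : ∀ z : ℂ, z ≠ 0 → ‖z‖ < T.r →
        ∑ j, (z ^ 2 * b j + a j) * deriv (poleMap T.φ Pole.infty) z j = 2 * -1 := by
      intro z hz0 hz
      have h2 := h1 z⁻¹ (by
        rw [norm_inv]; exact (inv_lt_inv₀ T.r_pos (norm_pos_iff.2 hz0)).2 hz)
      have h3 : ∀ j, deriv (fun w => reflected T.φ w j) z⁻¹ =
          -(z ^ 2) * deriv (poleMap T.φ Pole.infty) z j := by
        intro j
        have e1 : (fun w => reflected T.φ w j) = fun w => poleMap T.φ Pole.infty w⁻¹ j := by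
          funext w; rw [poleMap_infty_eq, inv_inv]
        have e2 : HasDerivAt (fun w => poleMap T.φ Pole.infty w j)
            (deriv (poleMap T.φ Pole.infty) z j) z⁻¹⁻¹ := by
          rw [inv_inv]
          exact hasDerivAt_pi.1
            (T.analyticAt_poleMap Pole.infty hz).differentiableAt.hasDerivAt j
        have e3 := e2.scomp z⁻¹ (hasDerivAt_inv (inv_ne_zero hz0))
        rw [e1]
        refine e3.deriv.trans ?_
        simp
      simp only [h3, Fin.sum_univ_two] at h2 ⊢
      field_simp at h2
      linear_combination -h2
    by_cases hz0 : z = 0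
    · subst hz0
      -- At the pole itself the identity holds by continuity.
      have hd : ContinuousAt (deriv (poleMap T.φ Pole.infty)) 0 :=
        (T.analyticAt_poleMap Pole.infty hz).deriv.continuousAt
      have hcont : ContinuousAt (fun z : ℂ =>
          ∑ j, (z ^ 2 * b j + a j) * deriv (poleMap T.φ Pole.infty) z j) 0 := by
        refine tendsto_finsetSum _ fun j _ => ?_
        refine Tendsto.mul ?_ (tendsto_pi_nhds.1 hd j)
        exact (by fun_prop : Continuous fun z : ℂ => z ^ 2 * b j + a j).tendsto 0
      refine tendsto_nhds_unique (hcont.tendsto.mono_left (nhdsWithin_le_nhds (s := {0}ᶜ))) ?_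
      refine tendsto_const_nhds.congr' ?_
      have hball : ∀ᶠ z : ℂ in 𝓝[≠] 0, z ∈ ball (0 : ℂ) T.r :=
        nhdsWithin_le_nhds (ball_mem_nhds 0 T.r_pos)
      filter_upwards [hball, self_mem_nhdsWithin] with z hz hz0
      exact (hpunct z hz0 (by simpa using hz)).symm
    · exact hpunct z hz0 hz

theorem weight_mul_quadratic (e : Pole) (a b : Fin 2 → ℂ) {z : ℂ} (hz : z ≠ 0) (j : Fin 2) :
    weight e (poleCoord e z ^ 2) * (z ^ 2 * a j + b j) =
      poleCoord e z ^ 2 * leadCoeff a b e j + constCoeff a b e j := by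
  cases e with
  | zero => simp [weight, leadCoeff, constCoeff, poleCoord]
  | infty =>
    simp only [weight, leadCoeff, constCoeff, poleCoord]
    field_simp
    ring

/-- The local expressions of the contact form agree on the overlaps of the pieces. -/
theorem contactForm_compatible {a b : Fin 2 → ℂ}
    (h : T.Normalized a b) (c c' : Piece) {p : T.Z} (hp : p ∈ (T.pieceChart c).source)
    (hp' : p ∈ (T.pieceChart c').source) :
    T.lineTransition c c' p • contactForm a b c (T.pieceChart c p) =
      (contactForm a b c' (T.pieceChart c' p)).comp
        ((tangentBundleCore 𝓘(ℂ, Model) T.Z).coordChange (T.chartOf c) (T.chartOf c') p) := by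
  have hself : ∀ c, p ∈ (T.pieceChart c).source →
      (tangentBundleCore 𝓘(ℂ, Model) T.Z).coordChange (T.chartOf c) (T.chartOf c) p =
        ContinuousLinearMap.id ℂ Model := fun c hc => T.tangentCoordChange_self hc
  have hforward : ∀ e, p ∈ (T.pieceChart Piece.annulus).source →
      p ∈ (T.pieceChart (Piece.disc e)).source →
      weight e (T.pieceChart (Piece.disc e) p).1 •
        contactForm a b Piece.annulus (T.pieceChart Piece.annulus p) =
      (contactForm a b (Piece.disc e) (T.pieceChart (Piece.disc e) p)).comp
        ((tangentBundleCore 𝓘(ℂ, Model) T.Z).coordChange (T.chartOf Piece.annulus)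
          (T.chartOf (Piece.disc e)) p) := by
    intro e hA hD
    have h0 := T.ne_zero_of_mem_source hA
    obtain ⟨h1, h2⟩ := T.overlap hA hD
    rw [T.tangentCoordChange_annulus_disc hA hD, h2]
    have h3 := h e _ h1
    have h4 := fun j => weight_mul_quadratic e a b h0 j
    have h5 := deriv_poleCoord e (T.pieceChart Piece.annulus p).1
    have h6 := poleSign_mul_self e
    refine ContinuousLinearMap.ext fun y => ?_
    simp only [contactForm, localCoord, ContinuousLinearMap.comp_apply, smul_apply,
      add_apply, ContinuousLinearMap.coe_fst', shearMap_apply, pairing_apply,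
      Fin.sum_univ_two, Pi.add_apply, Pi.smul_apply, smul_eq_mul, h5] at h3 ⊢
    linear_combination y.2 0 * h4 0 + y.2 1 * h4 1 -
      (1 / 2 * y.1 * poleSign e *
        weight e (poleCoord e (T.pieceChart Piece.annulus p).1 ^ 2)) * h3 -
      y.1 * weight e (poleCoord e (T.pieceChart Piece.annulus p).1 ^ 2) * h6
  rcases c with e | _ <;> rcases c' with e' | _
  · obtain rfl := T.eq_of_mem_disc_source hp hp'
    rw [hself _ hp, lineTransition_self, one_smul, ContinuousLinearMap.comp_id]
  · have h1 := hforward e hp' hp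
    have h2 := T.tangentCoordChange_comp (e := T.chartOf (Piece.disc e))
      (e' := T.chartOf Piece.annulus) hp hp'
    have h3 := T.weight_overlap_ne_zero hp' hp
    simp only [lineTransition]
    rw [inv_smul_eq_iff₀ h3, ← ContinuousLinearMap.smul_comp, h1, ContinuousLinearMap.comp_assoc,
      h2, ContinuousLinearMap.comp_id]
  · exact hforward e' hp hp'
  · rw [hself _ hp, lineTransition_self, one_smul, ContinuousLinearMap.comp_id]

/-- The twisted contact form on the twistor space. -/
def contactStructure (a b : Fin 2 → ℂ) (h : T.Normalized a b) : TwistedForm T.root :=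
  TwistedForm.ofLocal T.root (fun e => contactForm a b (T.pieceOf e))
    (fun e => (contDiff_contactForm a b _).contDiffOn) (by
      intro e e' p hp
      obtain ⟨c, rfl⟩ := T.exists_eq_chartOf e
      obtain ⟨c', rfl⟩ := T.exists_eq_chartOf e'
      simp only [pieceOf_chartOf, root_coordChange]
      rw [ContinuousLinearMap.smul_comp, ContinuousLinearMap.id_comp]
      exact T.contactForm_compatible h c c' hp.1 hp.2)

section

variable {a b : Fin 2 → ℂ} (h : T.Normalized a b)

/-- Over each piece the contact structure is the explicit form `contactForm`. -/
theorem localForm_contactStructure (c : Piece) {x : Model} (hx : x ∈ (T.pieceChart c).target) :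
    localForm (T.contactStructure a b h) (T.chartOf c) x = contactForm a b c x := by
  refine (localForm_ofLocal T.root _ _ _ (T.chartOf c) hx).trans ?_
  rw [pieceOf_chartOf]

theorem localForm_contactStructure_eventuallyEq (c : Piece) {x : Model}
    (hx : x ∈ (T.pieceChart c).target) :
    localForm (T.contactStructure a b h) (T.chartOf c) =ᶠ[𝓝 x] contactForm a b c := by
  filter_upwards [(T.pieceChart c).open_target.mem_nhds hx] with y hy
  exact T.localForm_contactStructure h c hy

theorem isContact_contactStructure (hab : a 0 * b 1 - a 1 * b 0 ≠ 0) :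
    IsContact (T.contactStructure a b h) := by
  intro e x hx
  obtain ⟨c, rfl⟩ := T.exists_eq_chartOf e
  rw [T.localForm_contactStructure h c hx,
    (T.localForm_contactStructure_eventuallyEq h c hx).fderiv_eq]
  cases c with
  | disc e => exact contactForm_disc_nondegenerate hab e x
  | annulus =>
    refine contactForm_annulus_nondegenerate hab x ?_
    have h1 := T.ne_zero_of_mem_source ((T.pieceChart Piece.annulus).map_target hx)
    rwa [(T.pieceChart Piece.annulus).right_inv hx] at h1

/-! ### Invariance under translations -/

theorem localCoord_add_smul (c : Piece) (z : ℂ) (v t : Fin 2 → ℂ) (s : ℂ) :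
    T.localCoord c (z, v + s • t) = T.localCoord c (z, v) + s • ((0, t) : Model) := by
  cases c with
  | annulus => simp [localCoord]
  | disc e =>
    refine Prod.ext (by simp [localCoord]) ?_
    simp only [localCoord, Prod.snd_add, Prod.smul_snd]
    abel

/-- An orbit of the action moves in direction `(0, t)` in each of the charts. -/
theorem orbit_chart (x : T.Pre) (t : Fin 2 → ℂ) {c : Piece}
    (hc : T.proj x ∈ (T.pieceChart c).source) :
    ContinuousAt (fun s : ℂ => T.point x.1.1 (x.1.2 + s • t)) 0 ∧
      HasDerivAt (fun s : ℂ => T.pieceChart c (T.point x.1.1 (x.1.2 + s • t)))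
        ((0, t) : Model) 0 := by
  obtain ⟨z, hz, hzc⟩ := T.exists_coord_of_mem_source hc
  have hline : Continuous fun s : ℂ => ((z, x.1.2 + s • t) : Model) := by fun_prop
  have hmem : ∀ᶠ s : ℂ in 𝓝 0, ((z, x.1.2 + s • t) : Model) ∈ T.domain c :=
    hline.tendsto 0 ((T.isOpen_domain c).mem_nhds (by simpa using hz))
  have hpt : (fun s : ℂ => T.point x.1.1 (x.1.2 + s • t)) =ᶠ[𝓝 0] fun s =>
      (T.pieceChart c).symm (T.localCoord c (z, x.1.2) + s • ((0, t) : Model)) := by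
    filter_upwards [hmem] with s hs
    rw [← T.localCoord_add_smul, T.pieceChart_symm_localCoord hs,
      T.point_of_mem _ (T.snd_mem_of_mem_domain hs)]
    exact congrArg T.proj (Subtype.ext (Prod.ext hzc rfl))
  have hcoord : (fun s : ℂ => T.pieceChart c (T.point x.1.1 (x.1.2 + s • t))) =ᶠ[𝓝 0] fun s =>
      T.localCoord c (z, x.1.2) + s • ((0, t) : Model) := by
    filter_upwards [hmem, hpt] with s hs hs'
    rw [hs', (T.pieceChart c).right_inv]
    rw [← T.localCoord_add_smul]
    exact T.localCoord_mem_target hs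
  constructor
  · refine ContinuousAt.congr ?_ hpt.symm
    refine ContinuousAt.comp (g := (T.pieceChart c).symm) ?_ (by fun_prop)
    simp only [zero_smul, add_zero]
    exact (T.pieceChart c).continuousAt_symm (T.localCoord_mem_target hz)
  · refine HasDerivAt.congr_of_eventuallyEq ?_ hcoord
    simpa using ((hasDerivAt_id (0 : ℂ)).smul_const ((0, t) : Model)).const_add
      (T.localCoord c (z, x.1.2))

/-- The action is generated by the constant vector field `(0, t)` in all three charts. -/
theorem localField_actionField (t : Fin 2 → ℂ) (e : atlas Model T.Z) {x : Model}
    (hx : x ∈ e.1.target) : localField (T.actionField t) e x = (0, t) := by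
  obtain ⟨c, rfl⟩ := T.exists_eq_chartOf e
  have hps := (T.chartOf c).1.map_target hx
  unfold localField actionField
  generalize (T.chartOf c).1.symm x = p at hps
  set y : T.Pre := Quotient.out p with hy
  have hyp : T.proj y = p := Quotient.out_eq p
  have hg0 : T.point y.1.1 (y.1.2 + (0 : ℂ) • t) = p := by
    rw [zero_smul, add_zero, T.point_of_mem _ y.2]
    exact hyp
  obtain ⟨c', hc'⟩ := T.exists_eq_chartOf (achart Model p)
  have hps' : p ∈ (T.pieceChart c').source := by
    have : p ∈ (achart Model p).1.source := mem_chart_source Model p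
    rw [hc'] at this
    exact this
  obtain ⟨hcont, hd'⟩ := T.orbit_chart y t (c := c') (hyp ▸ hps')
  obtain ⟨-, hd⟩ := T.orbit_chart y t (c := c) (hyp.symm ▸ hps)
  have h1 : (mfderiv 𝓘(ℂ, ℂ) 𝓘(ℂ, Model) (fun s : ℂ => T.point y.1.1 (y.1.2 + s • t)) 0 (1 : ℂ) :
      Model) = (0, t) := by
    have h2 := mfderiv_eq_deriv_chart (E := Model) hcont
    rw [hg0, hc'] at h2
    exact (h2 hd'.differentiableAt).trans hd'.deriv
  have h3 := tangentCoordChange_velocity (achart Model p) (T.chartOf c) hcont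
    (hg0.symm ▸ mem_chart_source Model p) (hg0.symm ▸ hps)
  rw [hg0, hc'] at h3
  have h4 := h3 hd'.differentiableAt
  rw [hc']
  refine Eq.trans ?_ (h4.trans hd.deriv)
  exact congrArg _ (h1.trans hd'.deriv.symm)

/-- The derivative of a function vanishes in a direction along which the function is constant. -/
theorem fderiv_apply_eq_zero_of_forall_eq {F : Type*} [NormedAddCommGroup F] [NormedSpace ℂ F]
    {f : Model → F} (hf : ∀ x y : Model, x.1 = y.1 → f x = f y) (x : Model) (t : Fin 2 → ℂ) :
    fderiv ℂ f x ((0, t) : Model) = 0 := by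
  by_cases hd : DifferentiableAt ℂ f x
  · rw [← hd.lineDeriv_eq_fderiv, lineDeriv]
    have : (fun s : ℂ => f (x + s • ((0, t) : Model))) = fun _ => f x := by
      funext s
      exact hf _ _ (by simp)
    rw [this, deriv_const]
  · rw [fderiv_zero_of_not_differentiableAt hd]
    rfl

/-- The contact form and the frame of `K^{-1/2}` depend on the first coordinate only, so all terms of
the Lie derivative along `(0, t)` vanish. -/
theorem isInvariant_contactStructure (t : Fin 2 → ℂ) :
    IsInvariant (T.contactStructure a b h) (T.actionField t) := by
  intro e x hx
  have hfield : localField (T.actionField t) e =ᶠ[𝓝 x] fun _ => ((0, t) : Model) := by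
    filter_upwards [e.1.open_target.mem_nhds hx] with y hy
    exact T.localField_actionField t e hy
  obtain ⟨c, rfl⟩ := T.exists_eq_chartOf e
  have hunit : (fun y => T.root.unit (T.chartOf c) ((T.chartOf c).1.symm y)) =ᶠ[𝓝 x]
      fun y => rootUnit c y.1 := by
    filter_upwards [(T.chartOf c).1.open_target.mem_nhds hx] with y hy
    simp only [root, pieceOf_chartOf, (T.chartOf c).1.right_inv hy]
  unfold localLieDerivative
  rw [hfield.fderiv_eq, hunit.fderiv_eq, hfield.eq_of_nhds,
    (T.localForm_contactStructure_eventuallyEq h c hx).fderiv_eq,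
    fderiv_apply_eq_zero_of_forall_eq fun x y hxy => contactForm_eq_of_fst_eq a b c hxy,
    fderiv_apply_eq_zero_of_forall_eq (f := fun y : Model => rootUnit c y.1)
      fun x y hxy => by rw [hxy]]
  simp only [fderiv_fun_const, Pi.zero_apply, ContinuousLinearMap.comp_zero, zero_div,
    ContinuousLinearMap.toLinearMap_zero, map_zero, sub_zero, mul_zero, add_zero]
  exact (zero_add _).trans
    (zero_smul ℂ (localForm (T.contactStructure a b h) (T.chartOf c) x : Model →L[ℂ] ℂ))

/-! ### The central twistor line -/

/-- Near each of its points the Riemann sphere is parametrised by the coordinate of a piece. -/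
theorem exists_piece_coord (e : Pole) (z₀ : ℂ) : ∃ (c : Piece) (k : ℂ → ℂ), AnalyticAt ℂ k z₀ ∧
    deriv k z₀ ≠ 0 ∧ (k z₀, 0) ∈ T.domain c ∧ ∀ᶠ z in 𝓝 z₀, e.coord z = c.coord (k z) := by
  have hr0 := T.r_pos
  by_cases h1 : ‖z₀‖ < T.r
  · refine ⟨Piece.disc e, fun z => z, analyticAt_id, ?_, ⟨h1, T.zero_mem_U⟩,
      Eventually.of_forall fun _ => rfl⟩
    rw [deriv_id'']
    exact one_ne_zero
  have hpos : 0 < ‖z₀‖ := hr0.trans_le (not_lt.1 h1)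
  have hz0 : z₀ ≠ 0 := norm_pos_iff.1 hpos
  have hne : ∀ᶠ z : ℂ in 𝓝 z₀, z ≠ 0 := isOpen_ne.mem_nhds hz0
  by_cases h2 : ‖z₀‖ < 2 / T.r
  · refine ⟨Piece.annulus, poleCoord e, analyticAt_poleCoord e hz0, deriv_poleCoord_ne_zero e hz0,
      ⟨?_, T.zero_mem_U⟩, ?_⟩
    · cases e with
      | zero => exact ⟨by change T.r / 2 < ‖z₀‖; linarith [not_lt.1 h1], h2⟩
      | infty =>
        simp only [poleCoord, norm_inv]
        constructor
        · rw [← inv_div]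
          exact (inv_lt_inv₀ (by positivity) hpos).2 h2
        · rw [← inv_div]
          exact (inv_lt_inv₀ hpos (by positivity)).2 (by linarith [not_lt.1 h1])
    · filter_upwards [hne] with z hz
      cases e <;> simp [Pole.coord, Piece.coord, poleCoord, hz]
  · refine ⟨Piece.disc e.opposite, fun z => z⁻¹, analyticAt_inv hz0, ?_, ⟨?_, T.zero_mem_U⟩, ?_⟩
    · rw [deriv_inv]
      simpa using hz0
    · simp only [norm_inv]
      rw [inv_lt_comm₀ hpos hr0]
      refine lt_of_lt_of_le ?_ (not_lt.1 h2)
      rw [inv_eq_one_div]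
      gcongr
      norm_num
    · filter_upwards [hne] with z hz
      exact (e.opposite_coord_inv hz).symm

theorem analyticAt_localCoord_zero {c : Piece} {k : ℂ → ℂ} {z₀ : ℂ} (hk : AnalyticAt ℂ k z₀)
    (hc : (k z₀, 0) ∈ T.domain c) : AnalyticAt ℂ (fun z => T.localCoord c (k z, 0)) z₀ := by
  cases c with
  | annulus => exact hk.prod analyticAt_const
  | disc e =>
    have h1 : AnalyticAt ℂ (fun z => poleMap T.φ e (k z)) z₀ :=
      AnalyticAt.fun_comp (T.analyticAt_poleMap e hc.1) hk
    exact (hk.pow 2).prod (analyticAt_const.add (analyticAt_const.fun_smul h1))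

theorem centralLine_eventuallyEq {e : Pole} {z₀ : ℂ} {c : Piece} {k : ℂ → ℂ}
    (hk : ContinuousAt k z₀) (hc : (k z₀, 0) ∈ T.domain c)
    (hek : ∀ᶠ z in 𝓝 z₀, e.coord z = c.coord (k z)) :
    ∀ᶠ z in 𝓝 z₀, T.centralLine (e.coord z) =
        (T.pieceChart c).symm (T.localCoord c (k z, 0)) ∧
      T.localCoord c (k z, 0) ∈ (T.pieceChart c).target := by
  have hmem : ∀ᶠ z in 𝓝 z₀, ((k z, 0) : Model) ∈ T.domain c :=
    (hk.prodMk continuousAt_const).tendsto ((T.isOpen_domain c).mem_nhds hc)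
  filter_upwards [hmem, hek] with z hz hez
  refine ⟨?_, T.localCoord_mem_target hz⟩
  rw [T.pieceChart_symm_localCoord hz]
  refine (T.point_of_mem _ T.zero_mem_U).trans ?_
  exact congrArg T.proj (Subtype.ext (Prod.ext hez rfl))

theorem isHolomorphicCurve_centralLine : IsHolomorphicCurve (E := Model) T.centralLine := by
  intro e z₀
  obtain ⟨c, k, hk, -, hc, hek⟩ := T.exists_piece_coord e z₀
  have h1 : ContMDiffAt 𝓘(ℂ, Model) 𝓘(ℂ, Model) ω (T.pieceChart c).symm
      (T.localCoord c (k z₀, 0)) :=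
    contMDiffAt_symm_of_mem_maximalAtlas (IsManifold.subset_maximalAtlas (T.chartOf c).2)
      (T.localCoord_mem_target hc)
  have h2 : ContMDiffAt 𝓘(ℂ, ℂ) 𝓘(ℂ, Model) ω (fun z => T.localCoord c (k z, 0)) z₀ :=
    (T.analyticAt_localCoord_zero hk hc).contDiffAt.contMDiffAt
  refine (h1.comp z₀ h2).congr_of_eventuallyEq ?_
  filter_upwards [T.centralLine_eventuallyEq hk.continuousAt hc hek] with z hz
  exact hz.1

/-- On the velocity of the central line the contact form is `k' (z)`, up to sign, if the coordinate
of the piece is `k z`: over the disc pieces this is the condition `∑ q_j φ_j' = 2` again. -/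
theorem contactForm_centralLine_ne_zero (h : T.Normalized a b)
    {c : Piece} {k : ℂ → ℂ} {z₀ : ℂ} (hk : AnalyticAt ℂ k z₀)
    (hk' : deriv k z₀ ≠ 0) (hc : (k z₀, 0) ∈ T.domain c) :
    contactForm a b c (T.localCoord c (k z₀, 0)) (deriv (fun z => T.localCoord c (k z, 0)) z₀) ≠
      0 := by
  have hkd := hk.differentiableAt.hasDerivAt
  cases c with
  | annulus =>
    have h1 : HasDerivAt (fun z => T.localCoord Piece.annulus (k z, 0)) _ z₀ :=
      hkd.prodMk (hasDerivAt_const z₀ (0 : Fin 2 → ℂ))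
    rw [h1.deriv]
    simpa [contactForm, pairing_apply] using hk'
  | disc e =>
    have h2 := (((T.analyticAt_poleMap e hc.1).differentiableAt.hasDerivAt.scomp z₀ hkd).const_smul
      (1 / 2 : ℂ)).const_add (0 : Fin 2 → ℂ)
    have h1 : HasDerivAt (fun z => T.localCoord (Piece.disc e) (k z, 0)) _ z₀ :=
      (hkd.fun_pow 2).prodMk h2
    rw [h1.deriv]
    have h3 := h e _ hc.1
    intro h0
    refine mul_ne_zero hk' (poleSign_ne_zero e) ?_
    simp only [contactForm, localCoord, pairing_apply, Fin.sum_univ_two, Pi.add_apply,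
      Pi.smul_apply, smul_eq_mul] at h0 h3
    linear_combination h0 - 1 / 2 * deriv k z₀ * h3

theorem eventually_nonzeroAlong_contactStructure :
    ∀ᶠ f : C(OnePoint ℂ, T.Z) in 𝓝 T.centralLine, IsHolomorphicCurve (E := Model) f →
      NonzeroAlong (T.contactStructure a b h) f := by
  refine eventually_nonzeroAlong _ _ T.isHolomorphicCurve_centralLine ?_ fun e z₀ _ => ?_
  · intro e
    obtain ⟨c, rfl⟩ := T.exists_eq_chartOf e
    exact (contDiff_contactForm a b c).continuous.continuousOn.congr fun x hx =>
      T.localForm_contactStructure h c hx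
  obtain ⟨c, k, hk, hk', hc, hek⟩ := T.exists_piece_coord e z₀
  have hev := T.centralLine_eventuallyEq hk.continuousAt hc hek
  have hcoord : (fun z => (T.chartOf c).1 (T.centralLine (e.coord z))) =ᶠ[𝓝 z₀]
      fun z => T.localCoord c (k z, 0) := by
    filter_upwards [hev] with z hz
    rw [hz.1]
    exact (T.pieceChart c).right_inv hz.2
  refine ⟨T.chartOf c, ?_, ?_⟩
  · rw [hev.self_of_nhds.1]
    exact (T.pieceChart c).map_target hev.self_of_nhds.2
  · rw [hcoord.deriv_eq, hcoord.eq_of_nhds,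
      T.localForm_contactStructure h c (T.localCoord_mem_target hc)]
    exact T.contactForm_centralLine_ne_zero h hk hk' hc

end

end ToricData

/-! ### The quadratic polynomials -/

/-- Two quadratic polynomials `a_j z² + b_j` form a basis only if their coefficient determinant, which
is their Wronskian up to the factor `2 z`, is non-zero. -/
theorem exists_coeff_of_basis (q : Module.Basis (Fin 2) ℂ evenQuadratics) :
    ∃ a b : Fin 2 → ℂ, a 0 * b 1 - a 1 * b 0 ≠ 0 ∧
      ∀ j z, (q j : ℂ[X]).eval z = a j * z ^ 2 + b j := by
  have h : ∀ j, ∃ a b : ℂ, a • (Polynomial.X ^ 2 : ℂ[X]) + b • 1 = q j := fun j =>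
    Submodule.mem_span_pair.1 (q j).2
  choose a b hab using h
  refine ⟨a, b, fun hdet => ?_, fun j z => by simp [← hab j]⟩
  have hli := Fintype.linearIndependent_iff.1 q.linearIndependent
  have hcomb : ∀ s t : ℂ, s * a 0 + t * a 1 = 0 → s * b 0 + t * b 1 = 0 → s = 0 ∧ t = 0 := by
    intro s t h1 h2
    have h3 : ∑ j, (![s, t] : Fin 2 → ℂ) j • q j = 0 := by
      apply Subtype.ext
      simp only [Fin.sum_univ_two, Matrix.cons_val_zero, Matrix.cons_val_one, Submodule.coe_add,
        Submodule.coe_smul, ← hab, Submodule.coe_zero]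
      rw [smul_add, smul_add, smul_smul, smul_smul, smul_smul, smul_smul, add_add_add_comm,
        ← add_smul, ← add_smul, h1, h2, zero_smul, zero_smul, add_zero]
    exact ⟨hli _ h3 0, hli _ h3 1⟩
  obtain ⟨hb1, hb0⟩ := hcomb (b 1) (-b 0) (by linear_combination hdet) (by ring)
  obtain ⟨ha1, ha0⟩ := hcomb (a 1) (-a 0) (by ring) (by linear_combination -hdet)
  have := (hcomb 1 0 (by simpa using ha0) (by simpa using hb0)).1
  exact one_ne_zero this

end ToricTwistor

theorem mainTheorem4 (T : ToricTwistor.ToricData)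
    (q : Module.Basis (Fin 2) ℂ ToricTwistor.evenQuadratics)
    (hq : ∀ z : ℂ, ‖z‖ < T.r →
      ∑ j, (q j : ℂ[X]).eval z * deriv (fun w => T.φ w j) z = 2)
    (hq_infty : ∀ z : ℂ, T.r⁻¹ < ‖z‖ →
      ∑ j, (q j : ℂ[X]).eval z * deriv (fun w => ToricTwistor.reflected T.φ w j) z = 2) :
    ∃ (N : ToricTwistor.AnticanonicalRoot ToricTwistor.Model T.Z)
      (θ : ToricTwistor.TwistedForm N),
      ToricTwistor.IsContact θ ∧
      (∀ t : Fin 2 → ℂ, ToricTwistor.IsInvariant θ (T.actionField t)) ∧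
      ToricTwistor.NonzeroAlong θ T.centralLine ∧
      ∀ᶠ f : C(OnePoint ℂ, T.Z) in 𝓝 T.centralLine,
        ToricTwistor.IsHolomorphicCurve (E := ToricTwistor.Model) f →
          ToricTwistor.NonzeroAlong θ f := by
  obtain ⟨a, b, hab, hqab⟩ := ToricTwistor.exists_coeff_of_basis q
  simp only [hqab] at hq hq_infty
  have h := T.normalized_of_sum_mul_deriv_eq hq hq_infty
  have hev := T.eventually_nonzeroAlong_contactStructure h
  exact ⟨T.root, T.contactStructure a b h, T.isContact_contactStructure h hab,
    T.isInvariant_contactStructure h, hev.self_of_nhds T.isHolomorphicCurve_centralLine, hev⟩
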